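/- Let $s\in(0,1)$, $T>0$, $a=1-2s$, and let $k:\mathbb R\to\mathbb R$ be a measurable, bounded, $T$-periodic function. Put $$Lu:=(-\partial_{xx})^s u+k(x)u,$$ where $(-\partial_{xx})^s$ is the Fourier multiplier with symbol $|\xi|^{2s}$. Let $L^2_T$ be the space of real-valued $T$-periodic functions on $\mathbb R$ that are square integrable over $(-T/2,T/2)$, functions equal almost everywhere being identified. Let $\mathcal H_T$ be the space of real-valued functions $U(x,y)$ on $\mathbb R\times[0,\infty)$ that are $T$-periodic in $x$ and weakly differentiable for $y>0$, with trace $U(\cdot,0)$ on $y=0$, and satisfy $$\int_{-T/2}^{T/2}\int_0^\infty y^a|\nabla U(x,y)|^2\,dy\,dx+\int_{-T/2}^{T/2}U(x,0)^2\,dx<\infty .$$ For $U,V\in\mathcal H_T$ let $$B(U,V)=d_s\int_{-T/2}^{T/2}\int_0^\infty y^a\,\nabla U\cdot\nabla V\,dy\,dx+\int_{-T/2}^{T/2}k(x)U(x,0)V(x,0)\,dx,\qquad d_s=2^{2s-1}\frac{\Gamma(s)}{\Gamma(1-s)} .$$ For $f\in L^2_T$, a weak periodic solution of $Lu=f$ is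 a function $u=U(\cdot,0)$ with $U\in\mathcal H_T$ such that $$B(U,V)=\int_{-T/2}^{T/2}f(x)V(x,0)\,dx\qquad\text{for all }V\in\mathcal H_T ;$$ for $\lambda\in\mathbb R$ and $g\in L^2_T$, a weak periodic solution of $Lu=\lambda u+g$ is such a $u$ with $f=\lambda u+g$. A number $\lambda\in\mathbb R$ is an eigenvalue of $L$ if $Lu=\lambda u$ has a weak periodic solution $u\not\equiv0$. **Theorem.** (i) There exists an at most countable set $\Lambda\subset\mathbb R$ of eigenvalues of $L$ such that, for every $\lambda\in\mathbb R$, the equation $$Lu=\lambda u+g$$ has a unique weak periodic solution $u$ for each $g\in L^2_T$ if and only if $\lambda\notin\Lambda$. (ii) If $\Lambda$ is infinite, then $\Lambda=\{\lambda_j\}_{j=1}^\infty$ is the set of values of a nondecreasing sequence with $\lambda_j\to+\infty$. -/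

import Mathlib

open MeasureTheory Set Filter Topology
open scoped ContDiff

noncomputable section

namespace PeriodicFractional

/-- One period `(-T/2, T/2]`. -/
def period (T : ℝ) : Set ℝ := Ioc (-(T / 2)) (T / 2)

/-- The half-strip `(-T/2, T/2] × (0, ∞)`, one period of the upper half-plane. -/
def strip (T : ℝ) : Set (ℝ × ℝ) := period T ×ˢ Ioi 0

/-- The weighted measure `y ^ a dx dy`, `a = 1 - 2 s`, on the half-strip. -/
def weight (s T : ℝ) : Measure (ℝ × ℝ) :=
  (volume.restrict (strip T)).withDensity fun p => ENNReal.ofReal (p.2 ^ (1 - 2 * s))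

/-- `L²_T`: the `T`-periodic real functions that are square integrable over a period. -/
structure MemL2 (T : ℝ) (u : ℝ → ℝ) : Prop where
  periodic : Function.Periodic u T
  memLp : MemLp u 2 (volume.restrict (period T))

/-- Smooth functions of `(x, y)`, `T`-periodic in `x` and vanishing for large `|y|`: the test
functions on the cylinder. They need not vanish at `y = 0`. -/
structure IsTest (T : ℝ) (φ : ℝ × ℝ → ℝ) : Prop where
  smooth : ContDiff ℝ ∞ φ
  periodic : ∀ x y, φ (x + T, y) = φ (x, y)
  support : ∃ R : ℝ, ∀ x y, R ≤ |y| → φ (x, y) = 0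

/-- `U`, defined on the closed half-plane and `T`-periodic in `x`, belongs to the energy space
`𝓗_T`, with weak gradient `(P, Q)` in the open half-plane:
`∫∫ y ^ a (P² + Q²) dx dy + ∫ U(x, 0)² dx < ∞`, the integrals being over one period.
As the test functions need not vanish on `y = 0`, the second integration by parts formula says
both that `Q = ∂U/∂y` weakly and that `x ↦ U (x, 0)` is the trace of `U` on `y = 0`. -/
structure MemEnergy (s T : ℝ) (U P Q : ℝ × ℝ → ℝ) : Prop where
  periodic : ∀ x y, 0 ≤ y → U (x + T, y) = U (x, y)
  locallyIntegrable : ∀ R : ℝ, IntegrableOn U (period T ×ˢ Ioc 0 R)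
  trace_mem : MemL2 T fun x => U (x, 0)
  memLp_dx : MemLp P 2 (weight s T)
  memLp_dy : MemLp Q 2 (weight s T)
  weak_dx : ∀ φ, IsTest T φ →
    ∫ p in strip T, U p * fderiv ℝ φ p (1, 0) = -∫ p in strip T, P p * φ p
  weak_dy : ∀ φ, IsTest T φ →
    ∫ p in strip T, U p * fderiv ℝ φ p (0, 1) =
      -(∫ p in strip T, Q p * φ p) - ∫ x in period T, U (x, 0) * φ (x, 0)

/-- The constant `d_s` in `(-∂ₓₓ)^s u = d_s · (-lim_{y ↓ 0} y ^ a ∂U/∂y)`,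
where `U` is the `s`-harmonic extension of `u`. -/
def dConst (s : ℝ) : ℝ := 2 ^ (2 * s - 1) * Real.Gamma s / Real.Gamma (1 - s)

/-- The bilinear form of `L = (-∂ₓₓ)^s + k` on the energy space, in terms of the functions `U`, `V`
and their weak gradients `(P, Q)`, `(P', Q')`. -/
def form (s T : ℝ) (k : ℝ → ℝ) (U P Q V P' Q' : ℝ × ℝ → ℝ) : ℝ :=
  dConst s * ∫ p, (P p * P' p + Q p * Q' p) ∂weight s T
    + ∫ x in period T, k x * U (x, 0) * V (x, 0)

/-- `u` is a weak `T`-periodic solution of `(-∂ₓₓ)^s u + k u = f`: it is the trace of some `U` in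
the energy space with `B(U, V) = ⟨f, V(·, 0)⟩` for every `V` in the energy space. -/
def IsWeakSolution (s T : ℝ) (k f u : ℝ → ℝ) : Prop :=
  ∃ U P Q : ℝ × ℝ → ℝ, MemEnergy s T U P Q ∧ (∀ x, U (x, 0) = u x) ∧
    ∀ V P' Q' : ℝ × ℝ → ℝ, MemEnergy s T V P' Q' →
      form s T k U P Q V P' Q' = ∫ x in period T, f x * V (x, 0)

/-- `L u = lam u + g` has a weak solution, unique up to equality almost everywhere. -/
def UniquelySolvable (s T : ℝ) (k : ℝ → ℝ) (lam : ℝ) (g : ℝ → ℝ) : Prop :=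
  (∃ u : ℝ → ℝ, IsWeakSolution s T k (fun x => lam * u x + g x) u) ∧
    ∀ u v : ℝ → ℝ, IsWeakSolution s T k (fun x => lam * u x + g x) u →
      IsWeakSolution s T k (fun x => lam * v x + g x) v → u =ᵐ[volume] v

/-- `lam` is an eigenvalue: `L u = lam u` has a nonzero weak solution. -/
def IsEigenvalue (s T : ℝ) (k : ℝ → ℝ) (lam : ℝ) : Prop :=
  ∃ u : ℝ → ℝ, IsWeakSolution s T k (fun x => lam * u x) u ∧ ¬ u =ᵐ[volume] 0

end PeriodicFractional

end

/-!
A function of finite energy is determined by its trace and weak gradient, so `𝓗_T` becomes a closed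
subspace of `L² × L²(y^a) × L²(y^a)`: the triples `(u, P, Q)` satisfying the compatibility relations
obtained by eliminating `U` from the two integrations by parts. On it the form of `L` satisfies
Gårding's inequality relative to the trace map `J` into `L²`. The map `J` is compact: testing
the compatibility relation of `(u, P, Q)` with `χ((|n| + 1) y)` times a trigonometric function of
frequency `n` expresses the corresponding Fourier coefficient of `u` as the inner product of the
gradient with a vector of norm `O((|n| + 1) ^ (-s))`, and distinct `n` give orthogonal vectors.
Lax–Milgram and the Fredholm alternative then give (i). Unit eigenvectors with eigenvalue at most
`C` are bounded in the energy norm and have orthonormal images under `J`, so by compactness there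
are finitely many of them, which gives (ii).
-/

open scoped InnerProductSpace

section CompactOperators

variable {H L : Type*} [NormedAddCommGroup H] [InnerProductSpace ℝ H]
  [NormedAddCommGroup L] [InnerProductSpace ℝ L]

theorem norm_sub_sum_inner_smul_le {ι : Type*} (b : HilbertBasis ι ℝ L)
    (s : Finset ι) (y : L) {r : ℝ} (hr : 0 ≤ r)
    (h : ∀ t : Finset ι, Disjoint t s → ∑ i ∈ t, ⟪b i, y⟫_ℝ ^ 2 ≤ r ^ 2) :
    ‖y - ∑ i ∈ s, ⟪b i, y⟫_ℝ • b i‖ ≤ r := by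
  classical
  set z := y - ∑ i ∈ s, ⟪b i, y⟫_ℝ • b i with hz
  have hcoeff (i : ι) : ⟪b i, z⟫_ℝ = if i ∉ s then ⟪b i, y⟫_ℝ else 0 := by
    simp only [hz, inner_sub_right, inner_sum, inner_smul_right,
      orthonormal_iff_ite.1 b.orthonormal, mul_ite, mul_one, mul_zero, Finset.sum_ite_eq]
    split_ifs <;> simp
  have hsum : HasSum (fun i => ⟪b i, z⟫_ℝ ^ 2) (‖z‖ ^ 2) := by
    simpa only [real_inner_comm z, ← sq, real_inner_self_eq_norm_sq]
      using b.hasSum_inner_mul_inner z z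
  refine le_of_sq_le_sq (hasSum_le_of_sum_le hsum fun t => ?_) hr
  refine le_of_eq_of_le ?_ (h {i ∈ t | i ∉ s} (Finset.disjoint_left.2 fun i hi =>
    (Finset.mem_filter.1 hi).2))
  rw [Finset.sum_filter]
  exact Finset.sum_congr rfl fun i _ => by rw [hcoeff]; split_ifs <;> simp

theorem isCompactOperator_of_hilbertBasis_tails {ι : Type*} [CompleteSpace L]
    (b : HilbertBasis ι ℝ L) (J : H →L[ℝ] L)
    (h : ∀ ε > 0, ∃ s : Finset ι, ∀ x, ∀ t : Finset ι, Disjoint t s →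
      ∑ i ∈ t, ⟪b i, J x⟫_ℝ ^ 2 ≤ (ε * ‖x‖) ^ 2) : IsCompactOperator J := by
  have hclosed : IsClosed {f : H →L[ℝ] L | IsCompactOperator f} :=
    isClosed_setOfPred_isCompactOperator
  refine hclosed.closure_subset (Metric.mem_closure_iff.2 fun ε hε => ?_)
  obtain ⟨s, hs⟩ := h (ε / 2) (by positivity)
  let F : H →L[ℝ] L := ∑ i ∈ s, (ContinuousLinearMap.toSpanSingleton ℝ (b i)).comp
    ((innerSL ℝ (b i)).comp J)
  have hF : F ∈ compactOperator (RingHom.id ℝ) H L := Submodule.sum_mem _ fun i _ =>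
    (isCompactOperator_of_locallyCompactSpace_rng
      (ContinuousLinearMap.toSpanSingleton ℝ (b i))).comp_clm _
  have hFx (x : H) : (J - F) x = J x - ∑ i ∈ s, ⟪b i, J x⟫_ℝ • b i := by simp [F]
  refine ⟨F, hF, ?_⟩
  calc dist J F = ‖J - F‖ := dist_eq_norm J F
    _ ≤ ε / 2 := ContinuousLinearMap.opNorm_le_bound _ (by positivity) fun x => by
      rw [hFx]
      exact norm_sub_sum_inner_smul_le b s (J x) (by positivity) (hs x)
    _ < ε := half_lt_self hε

theorem sum_inner_sq_le_of_orthogonal {ι : Type*} (v : ι → L) (t : Finset ι) {r : ℝ}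
    (hv : ∀ i ∈ t, ‖v i‖ ≤ r) (ho : ∀ i ∈ t, ∀ j ∈ t, i ≠ j → ⟪v i, v j⟫_ℝ = 0) (x : L) :
    ∑ i ∈ t, ⟪v i, x⟫_ℝ ^ 2 ≤ r ^ 2 * ‖x‖ ^ 2 := by
  set S := ∑ i ∈ t, ⟪v i, x⟫_ℝ ^ 2 with hS
  set y := ∑ i ∈ t, ⟪v i, x⟫_ℝ • v i with hy
  have hyx : ⟪y, x⟫_ℝ = S := by
    simp only [hy, hS, sum_inner, real_inner_smul_left, sq]
  have hyy : ‖y‖ ^ 2 ≤ r ^ 2 * S := by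
    rw [← real_inner_self_eq_norm_sq, hy, sum_inner, hS, Finset.mul_sum]
    refine Finset.sum_le_sum fun i hi => ?_
    rw [inner_sum, Finset.sum_eq_single_of_mem i hi fun j hj hji => by
      rw [real_inner_smul_left, real_inner_smul_right, ho i hi j hj hji.symm, mul_zero, mul_zero],
      real_inner_smul_left, real_inner_smul_right, real_inner_self_eq_norm_sq]
    calc ⟪v i, x⟫_ℝ * (⟪v i, x⟫_ℝ * ‖v i‖ ^ 2) = ‖v i‖ ^ 2 * ⟪v i, x⟫_ℝ ^ 2 := by ring
      _ ≤ r ^ 2 * ⟪v i, x⟫_ℝ ^ 2 := by gcongr; exact hv i hi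
  have hS0 : 0 ≤ S := Finset.sum_nonneg fun i _ => sq_nonneg _
  have hSS : S * S ≤ r ^ 2 * ‖x‖ ^ 2 * S :=
    calc S * S = S ^ 2 := (sq S).symm
      _ ≤ (‖y‖ * ‖x‖) ^ 2 := pow_le_pow_left₀ hS0 (hyx ▸ real_inner_le_norm y x) 2
      _ = ‖y‖ ^ 2 * ‖x‖ ^ 2 := mul_pow _ _ _
      _ ≤ r ^ 2 * S * ‖x‖ ^ 2 := by gcongr
      _ = r ^ 2 * ‖x‖ ^ 2 * S := by ring
  rcases hS0.eq_or_lt with h0 | h0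
  · rw [← h0]; positivity
  · exact le_of_mul_le_mul_right hSS h0

theorem finite_of_orthonormal_of_mem_isCompact {ι : Type*} {v : ι → L} (hv : Orthonormal ℝ v)
    {K : Set L} (hK : IsCompact K) (hvK : ∀ i, v i ∈ K) : Finite ι := by
  by_contra hι
  have : Infinite ι := not_finite_iff_infinite.1 hι
  let w : ℕ → L := v ∘ Infinite.natEmbedding ι
  have hw : Orthonormal ℝ w := hv.comp _ (Infinite.natEmbedding ι).injective
  obtain ⟨y, -, φ, hφ, hlim⟩ := hK.tendsto_subseq (x := w) fun n => hvK _
  obtain ⟨N, hN⟩ := Metric.cauchySeq_iff'.1 hlim.cauchySeq 1 one_pos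
  have hdist : ‖w (φ (N + 1)) - w (φ N)‖ < 1 := by
    simpa [dist_eq_norm] using hN (N + 1) N.le_succ
  have hsq := norm_sub_sq_real (w (φ (N + 1))) (w (φ N))
  rw [hw.2 (hφ N.lt_succ_self).ne', hw.1, hw.1] at hsq
  nlinarith [norm_nonneg (w (φ (N + 1)) - w (φ N))]

theorem exists_eq_smul_add_of_isCompactOperator [CompleteSpace H] {K : H →L[ℝ] H}
    (hK : IsCompactOperator K) {ν : ℝ} (hinj : ∀ h, h = ν • K h → h = 0) (y : H) :
    ∃ h, h = ν • K h + y := by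
  rcases eq_or_ne ν 0 with rfl | hν
  · exact ⟨y, by simp⟩
  rcases hK.hasEigenvalue_or_mem_resolventSet (inv_ne_zero hν) with hev | hres
  · obtain ⟨v, hv⟩ := hev.exists_hasEigenvector
    have hKv : K v = ν⁻¹ • v := hv.apply_eq_smul
    exact (hv.2 (hinj v (by rw [hKv, smul_inv_smul₀ hν]))).elim
  · rw [spectrum.mem_resolventSet_iff, ContinuousLinearMap.isUnit_iff_bijective] at hres
    obtain ⟨h, hh⟩ := hres.2 (ν⁻¹ • y)
    have hK' : ν⁻¹ • h - K h = ν⁻¹ • y := by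
      rw [← hh]; simp [Algebra.algebraMap_eq_smul_one]
    refine ⟨h, ?_⟩
    rw [← sub_eq_iff_eq_add', ← smul_inv_smul₀ hν (h - ν • K h), smul_sub, inv_smul_smul₀ hν, hK',
      smul_inv_smul₀ hν]

end CompactOperators

section FormsRelativeToAnOperator

variable {H L : Type*} [NormedAddCommGroup H] [InnerProductSpace ℝ H]
  [NormedAddCommGroup L] [InnerProductSpace ℝ L]
  {J : H →L[ℝ] L} {B : H →L[ℝ] H →L[ℝ] ℝ} {c m lam mu : ℝ}

/-- Gårding's inequality: the form `B`, shifted by `m` times the square of the norm pulled back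
along `J`, is coercive with constant `c`. -/
structure IsGarding (J : H →L[ℝ] L) (B : H →L[ℝ] H →L[ℝ] ℝ) (c m : ℝ) : Prop where
  pos : 0 < c
  bound : ∀ h, c * ‖h‖ ^ 2 ≤ B h h + m * ‖J h‖ ^ 2

/-- `h` is a weak solution of `A h = lam • J h + g`, where the operator `A` is given by the form `B`
through `⟪A h, J h'⟫ = B h h'`. -/
def IsFormSolution (J : H →L[ℝ] L) (B : H →L[ℝ] H →L[ℝ] ℝ) (lam : ℝ) (g : L) (h : H) : Prop :=
  ∀ h', B h h' = lam * ⟪J h, J h'⟫_ℝ + ⟪g, J h'⟫_ℝ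

/-- `lam` is an eigenvalue, in the weak sense of `IsFormSolution`, of the operator given by `B`. -/
def IsFormEigenvalue (J : H →L[ℝ] L) (B : H →L[ℝ] H →L[ℝ] ℝ) (lam : ℝ) : Prop :=
  ∃ h, h ≠ 0 ∧ IsFormSolution J B lam 0 h

theorem isFormSolution_zero_iff {h : H} :
    IsFormSolution J B lam 0 h ↔ ∀ h', B h h' = lam * ⟪J h, J h'⟫_ℝ := by
  simp only [IsFormSolution, inner_zero_left, add_zero]

theorem IsFormSolution.smul {h : H} (hh : IsFormSolution J B lam 0 h) (r : ℝ) :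
    IsFormSolution J B lam 0 (r • h) := by
  rw [isFormSolution_zero_iff] at hh ⊢
  intro h'
  simp only [map_smul, smul_apply, hh h', smul_eq_mul, real_inner_smul_left, mul_left_comm]

theorem IsFormSolution.sub {g : L} {h₁ h₂ : H} (hh₁ : IsFormSolution J B lam g h₁)
    (hh₂ : IsFormSolution J B lam g h₂) : IsFormSolution J B lam 0 (h₁ - h₂) := by
  rw [isFormSolution_zero_iff]
  intro h'
  rw [map_sub, sub_apply, hh₁ h', hh₂ h', map_sub, inner_sub_left]
  ring

theorem IsFormSolution.inner_eq_zero (hsymm : ∀ h h', B h h' = B h' h) {v w : H}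
    (hv : IsFormSolution J B lam 0 v) (hw : IsFormSolution J B mu 0 w) (hne : lam ≠ mu) :
    ⟪J v, J w⟫_ℝ = 0 := by
  rw [isFormSolution_zero_iff] at hv hw
  have h : (lam - mu) * ⟪J v, J w⟫_ℝ = 0 := by
    rw [sub_mul, ← hv w, hsymm, hw v, real_inner_comm, sub_self]
  exact (mul_eq_zero.1 h).resolve_left (sub_ne_zero.2 hne)

theorem IsGarding.eq_zero_of_map_eq_zero (hB : IsGarding J B c m) {h : H}
    (hh : IsFormSolution J B lam 0 h) (hJ : J h = 0) : h = 0 := by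
  have hbound := hB.bound h
  rw [isFormSolution_zero_iff.1 hh h, hJ, inner_zero_left, norm_zero] at hbound
  have : c * ‖h‖ ^ 2 = 0 := le_antisymm (by simpa using hbound) (by have := hB.pos; positivity)
  simpa [hB.pos.ne'] using this

theorem IsGarding.exists_unit_eigenvector (hB : IsGarding J B c m)
    (hlam : IsFormEigenvalue J B lam) : ∃ v, ‖J v‖ = 1 ∧ IsFormSolution J B lam 0 v := by
  obtain ⟨h, h0, hh⟩ := hlam
  have hJ : ‖J h‖ ≠ 0 := norm_ne_zero_iff.2 fun e => h0 (hB.eq_zero_of_map_eq_zero hh e)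
  refine ⟨‖J h‖⁻¹ • h, ?_, hh.smul _⟩
  rw [map_smul, norm_smul, norm_inv, norm_norm, inv_mul_cancel₀ hJ]

theorem IsGarding.norm_le_of_eigenvector (hB : IsGarding J B c m) {v : H}
    (hv : IsFormSolution J B lam 0 v) (hJ : ‖J v‖ = 1) : ‖v‖ ≤ √((lam + m) / c) := by
  refine Real.le_sqrt_of_sq_le ((le_div_iff₀ hB.pos).2 ?_)
  have hbound := hB.bound v
  rw [isFormSolution_zero_iff.1 hv v, real_inner_self_eq_norm_sq, hJ] at hbound
  linarith

theorem IsGarding.finite_eigenvalues_inter_Iic (hB : IsGarding J B c m)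
    (hJ : IsCompactOperator J) (hsymm : ∀ h h', B h h' = B h' h) (C : ℝ) :
    ({lam | IsFormEigenvalue J B lam} ∩ Iic C).Finite := by
  choose v hv1 hv using fun lam : ↥({lam | IsFormEigenvalue J B lam} ∩ Iic C) =>
    hB.exists_unit_eigenvector lam.2.1
  have hortho : Orthonormal ℝ fun lam => J (v lam) :=
    ⟨hv1, fun lam mu hne => (hv lam).inner_eq_zero hsymm (hv mu) (Subtype.coe_ne_coe.2 hne)⟩
  obtain ⟨K, hK, hKsub⟩ := hJ.image_closedBall_subset_compact (𝕜₁ := ℝ) (f := (J : H →ₗ[ℝ] L))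
    (√((C + m) / c))
  refine finite_coe_iff.1 (finite_of_orthonormal_of_mem_isCompact hortho hK fun lam =>
    hKsub ⟨v lam, mem_closedBall_zero_iff.2 ?_, rfl⟩)
  have := hB.pos
  exact (hB.norm_le_of_eigenvector (hv lam) (hv1 lam)).trans (by gcongr; exact lam.2.2)

variable [CompleteSpace H] [CompleteSpace L]

theorem IsGarding.exists_resolvent (hB : IsGarding J B c m) :
    ∃ R : L →L[ℝ] H, ∀ f h, h = R f ↔ ∀ h', B h h' + m * ⟪J h, J h'⟫_ℝ = ⟪f, J h'⟫_ℝ := by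
  let Bm : H →L[ℝ] H →L[ℝ] ℝ :=
    B + m • (isBoundedBilinearMap_inner (𝕜 := ℝ)).toContinuousLinearMap.bilinearComp J J
  have hBm (h h' : H) : Bm h h' = B h h' + m * ⟪J h, J h'⟫_ℝ := rfl
  have hcoercive : IsCoercive Bm := ⟨c, hB.pos, fun h => by
    rw [hBm, real_inner_self_eq_norm_sq, mul_assoc, ← sq]
    exact hB.bound h⟩
  let A := hcoercive.continuousLinearEquivOfBilin
  refine ⟨(A.symm : H →L[ℝ] H).comp (ContinuousLinearMap.adjoint J), fun f h => ?_⟩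
  rw [ContinuousLinearMap.comp_apply, ContinuousLinearEquiv.coe_coe, A.eq_symm_apply]
  refine (ext_iff_inner_right ℝ).trans (forall_congr' fun h' => ?_)
  rw [hcoercive.continuousLinearEquivOfBilin_apply, hBm, ContinuousLinearMap.adjoint_inner_left]

theorem IsGarding.exists_isFormSolution (hB : IsGarding J B c m) (hJ : IsCompactOperator J)
    (hlam : ¬ IsFormEigenvalue J B lam) (g : L) : ∃ h, IsFormSolution J B lam g h := by
  obtain ⟨R, hR⟩ := hB.exists_resolvent
  have hsol (g : L) (h : H) :
      IsFormSolution J B lam g h ↔ h = (lam + m) • (R.comp J) h + R g := by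
    rw [ContinuousLinearMap.comp_apply, ← map_smul, ← map_add, hR]
    refine forall_congr' fun h' => ?_
    rw [inner_add_left, real_inner_smul_left]
    constructor <;> intro e <;> linarith
  simp only [hsol]
  refine exists_eq_smul_add_of_isCompactOperator (hJ.clm_comp R) (fun h hh => ?_) (R g)
  by_contra h0
  exact hlam ⟨h, h0, (hsol 0 h).2 (by rwa [map_zero, add_zero])⟩

end FormsRelativeToAnOperator

section Enumeration

variable {α : Type*} [LinearOrder α] {S : Set α}

theorem exists_strictMono_range_eq (hS : ∀ C, (S ∩ Iic C).Finite) (hinf : S.Infinite) :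
    ∃ l : ℕ → α, StrictMono l ∧ range l = S := by
  have : Infinite S := hinf.to_subtype
  have hIic (x : S) : (Iic x).Finite :=
    .of_finite_image ((hS x).subset (by rintro _ ⟨y, hy, rfl⟩; exact ⟨y.2, hy⟩))
      Subtype.val_injective.injOn
  let : LocallyFiniteOrder S :=
    LocallyFiniteOrder.ofFiniteIcc fun x y => (hIic y).subset Icc_subset_Iic_self
  let : SuccOrder S := LinearLocallyFiniteOrder.succOrder S
  let : PredOrder S := LinearLocallyFiniteOrder.predOrder S
  obtain ⟨x⟩ : Nonempty S := inferInstance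
  obtain ⟨a, ha, hmin⟩ := (hIic x).exists_minimal ⟨x, le_rfl⟩
  let : OrderBot S :=
    { bot := a
      bot_le := fun y => (le_total a y).elim id fun h => hmin (h.trans ha) h }
  have : NoMaxOrder S := ⟨fun x => by
    by_contra! h
    exact infinite_univ ((hIic x).subset fun y _ => h y)⟩
  let e : S ≃o ℕ := orderIsoNatOfLinearSuccPredArch
  refine ⟨fun n => e.symm n, fun _ _ h => e.symm.strictMono h, ?_⟩
  change range (Subtype.val ∘ e.symm) = S
  rw [e.symm.surjective.range_comp, Subtype.range_coe]

theorem countable_of_finite_inter_Iic (hS : ∀ C, (S ∩ Iic C).Finite) : S.Countable := by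
  rcases S.finite_or_infinite with hfin | hinf
  · exact hfin.countable
  · obtain ⟨l, -, rfl⟩ := exists_strictMono_range_eq hS hinf
    exact countable_range l

theorem exists_monotone_tendsto_atTop_range_eq (hS : ∀ C, (S ∩ Iic C).Finite)
    (hinf : S.Infinite) : ∃ l : ℕ → α, Monotone l ∧ range l = S ∧ Tendsto l atTop atTop := by
  obtain ⟨l, hl, rfl⟩ := exists_strictMono_range_eq hS hinf
  refine ⟨l, hl.monotone, rfl, tendsto_atTop_atTop_of_monotone hl.monotone fun C => ?_⟩
  by_contra! hC
  exact hinf ((hS C).subset fun x hx => ⟨hx, by obtain ⟨n, rfl⟩ := hx; exact (hC n).le⟩)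

end Enumeration

noncomputable section

namespace PeriodicFractional

section TrigonometricBasis

variable {T : ℝ}

/-- The normalised trigonometric function `(cos + sin) (2 π n x / T) / √T`: as `n` ranges over the
integers, these functions form a basis of the real `L²` space of a period. -/
def trig (T : ℝ) (n : ℤ) (x : ℝ) : ℝ :=
  (Real.cos (2 * Real.pi * n / T * x) + Real.sin (2 * Real.pi * n / T * x)) / √T

theorem trig_neg (T : ℝ) (n : ℤ) (x : ℝ) : trig T (-n) x =
    (Real.cos (2 * Real.pi * n / T * x) - Real.sin (2 * Real.pi * n / T * x)) / √T := by
  have h : 2 * Real.pi * ((-n : ℤ) : ℝ) / T * x = -(2 * Real.pi * n / T * x) := by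
    push_cast; ring
  rw [trig, h, Real.cos_neg, Real.sin_neg, ← sub_eq_add_neg]

theorem contDiff_trig (T : ℝ) (n : ℤ) : ContDiff ℝ ∞ (trig T n) := by
  unfold trig; fun_prop

theorem continuous_trig (T : ℝ) (n : ℤ) : Continuous (trig T n) := (contDiff_trig T n).continuous

theorem hasDerivAt_trig (T : ℝ) (n : ℤ) (x : ℝ) :
    HasDerivAt (trig T n) (2 * Real.pi * n / T * trig T (-n) x) x := by
  have h : HasDerivAt (fun x : ℝ => 2 * Real.pi * n / T * x) (2 * Real.pi * n / T) x := by
    simpa using (hasDerivAt_id x).const_mul (2 * Real.pi * n / T)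
  refine ((h.cos.add h.sin).div_const (√T)).congr_deriv ?_
  rw [trig_neg]
  ring

theorem trig_periodic (hT : 0 < T) (n : ℤ) : Function.Periodic (trig T n) T := fun x => by
  have h : 2 * Real.pi * n / T * (x + T) = 2 * Real.pi * n / T * x + n * (2 * Real.pi) := by
    field_simp
  simp only [trig, h, Real.cos_add_int_mul_two_pi, Real.sin_add_int_mul_two_pi]

theorem abs_trig_le (T : ℝ) (n : ℤ) (x : ℝ) : |trig T n x| ≤ 2 / √T := by
  rw [trig, abs_div, abs_of_nonneg (Real.sqrt_nonneg T)]
  gcongr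
  refine (abs_add_le _ _).trans ?_
  linarith [Real.abs_cos_le_one (2 * Real.pi * n / T * x),
    Real.abs_sin_le_one (2 * Real.pi * n / T * x)]

instance : IsFiniteMeasure (volume.restrict (period T)) := by
  unfold period; infer_instance

theorem integral_period (hT : 0 < T) {E : Type*} [NormedAddCommGroup E] [NormedSpace ℝ E]
    (f : ℝ → E) : ∫ x in period T, f x = ∫ x in (-(T / 2))..(T / 2), f x := by
  rw [intervalIntegral.integral_of_le (by linarith), period]

theorem memLp_trig (T : ℝ) (n : ℤ) : MemLp (trig T n) 2 (volume.restrict (period T)) :=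
  MemLp.of_bound (continuous_trig T n).aestronglyMeasurable (2 / √T)
    (ae_of_all _ fun x => abs_trig_le T n x)

theorem integral_cos_period (hT : 0 < T) (k : ℤ) :
    ∫ x in (-(T / 2))..(T / 2), Real.cos (2 * Real.pi * k / T * x) = if k = 0 then T else 0 := by
  split_ifs with hk
  · simp [hk]
  · have hk' : (k : ℝ) ≠ 0 := Int.cast_ne_zero.2 hk
    have hright : 2 * Real.pi * k / T * (T / 2) = k * Real.pi := by field_simp
    have hleft : 2 * Real.pi * k / T * -(T / 2) = -(k * Real.pi) := by field_simp
    rw [intervalIntegral.integral_comp_mul_left (fun x => Real.cos x) (by positivity),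
      integral_cos, hright, hleft, Real.sin_neg, Real.sin_int_mul_pi, neg_zero, sub_zero, smul_zero]

theorem integral_sin_period (T : ℝ) (k : ℤ) :
    ∫ x in (-(T / 2))..(T / 2), Real.sin (2 * Real.pi * k / T * x) = 0 := by
  have h := intervalIntegral.integral_comp_neg (a := -(T / 2)) (b := T / 2)
    fun x => Real.sin (2 * Real.pi * k / T * x)
  simp only [mul_neg, Real.sin_neg, intervalIntegral.integral_neg, neg_neg] at h
  linarith

theorem integral_trig_mul_trig (hT : 0 < T) (n m : ℤ) :
    ∫ x in period T, trig T n x * trig T m x = if n = m then 1 else 0 := by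
  have hprod (x : ℝ) : trig T n x * trig T m x =
      (Real.cos (2 * Real.pi * ((n - m : ℤ) : ℝ) / T * x) +
        Real.sin (2 * Real.pi * ((n + m : ℤ) : ℝ) / T * x)) / T := by
    have hsub : 2 * Real.pi * ((n - m : ℤ) : ℝ) / T * x =
      2 * Real.pi * n / T * x - 2 * Real.pi * m / T * x := by push_cast; ring
    have hadd : 2 * Real.pi * ((n + m : ℤ) : ℝ) / T * x =
      2 * Real.pi * n / T * x + 2 * Real.pi * m / T * x := by push_cast; ring
    rw [hsub, hadd, Real.cos_sub, Real.sin_add, trig, trig, div_mul_div_comm,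
      Real.mul_self_sqrt hT.le]
    ring
  simp only [hprod]
  rw [integral_period hT, intervalIntegral.integral_div, intervalIntegral.integral_add
    (Continuous.intervalIntegrable (by fun_prop) _ _)
    (Continuous.intervalIntegrable (by fun_prop) _ _), integral_cos_period hT,
    integral_sin_period, add_zero, ite_div, zero_div, div_self hT.ne']
  simp only [sub_eq_zero]

theorem fourier_neg_eq_trig (hT : 0 < T) (n : ℤ) (x : ℝ) :
    fourier (-n) (x : AddCircle (T / 2 - -(T / 2))) =
      √T / 2 * ((1 - Complex.I) * trig T n x + (1 + Complex.I) * trig T (-n) x) := by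
  have harg : 2 * (Real.pi : ℂ) * Complex.I * ((-n : ℤ) : ℂ) * x / ((T / 2 - -(T / 2) : ℝ) : ℂ) =
      ((-(2 * Real.pi * n / T * x) : ℝ) : ℂ) * Complex.I := by
    rw [sub_neg_eq_add, add_halves]; push_cast; ring
  have hsqrt : (√T : ℂ) ≠ 0 := Complex.ofReal_ne_zero.2 (Real.sqrt_pos.2 hT).ne'
  rw [fourier_coe_apply, harg, Complex.exp_mul_I, ← Complex.ofReal_cos, ← Complex.ofReal_sin,
    Real.cos_neg, Real.sin_neg, trig_neg, trig]
  push_cast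
  field_simp
  ring

theorem fourierCoeffOn_eq_zero_of_integral_trig_eq_zero (hT : 0 < T) (hab : -(T / 2) < T / 2)
    {f : ℝ → ℝ} (hf : MemLp f 2 (volume.restrict (period T)))
    (h : ∀ n, ∫ x in period T, trig T n x * f x = 0) (n : ℤ) :
    fourierCoeffOn hab (fun x => (f x : ℂ)) n = 0 := by
  have hint (n : ℤ) : Integrable (fun x => ((trig T n x * f x : ℝ) : ℂ))
      (volume.restrict (period T)) := ((memLp_trig T n).integrable_mul hf).ofReal
  have hzero (n : ℤ) : ∫ x in period T, ((trig T n x * f x : ℝ) : ℂ) = 0 := by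
    rw [integral_complex_ofReal, h, Complex.ofReal_zero]
  have hsplit (x : ℝ) : fourier (-n) (x : AddCircle (T / 2 - -(T / 2))) • (f x : ℂ) =
      (√T / 2 * (1 - Complex.I)) * ((trig T n x * f x : ℝ) : ℂ) +
        (√T / 2 * (1 + Complex.I)) * ((trig T (-n) x * f x : ℝ) : ℂ) := by
    rw [fourier_neg_eq_trig hT, smul_eq_mul]
    push_cast
    ring
  simp only [fourierCoeffOn_eq_integral, ← integral_period hT, hsplit]
  rw [integral_add ((hint n).const_mul _) ((hint (-n)).const_mul _), integral_const_mul,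
    integral_const_mul, hzero, hzero, mul_zero, mul_zero, add_zero, smul_zero]

theorem ae_eq_zero_of_integral_trig_eq_zero (hT : 0 < T) {f : ℝ → ℝ}
    (hf : MemLp f 2 (volume.restrict (period T)))
    (h : ∀ n, ∫ x in period T, trig T n x * f x = 0) : f =ᵐ[volume.restrict (period T)] 0 := by
  have hab : -(T / 2) < T / 2 := by linarith
  have hf' : MemLp (fun x => (f x : ℂ)) 2 (volume.restrict (period T)) := hf.ofReal
  have hparseval := hasSum_sq_fourierCoeffOn hab hf'
  simp only [fourierCoeffOn_eq_zero_of_integral_trig_eq_zero hT hab hf h, norm_zero, ne_eq,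
    OfNat.ofNat_ne_zero, not_false_eq_true, zero_pow] at hparseval
  have hnorm : ∫ x in period T, ‖(f x : ℂ)‖ ^ 2 = 0 := by
    rw [integral_period hT]
    exact (smul_eq_zero.1 (hparseval.unique hasSum_zero)).resolve_left
      (inv_ne_zero (by linarith))
  rw [integral_eq_zero_iff_of_nonneg (fun x => by positivity)
    ((memLp_two_iff_integrable_sq_norm hf'.1).1 hf')] at hnorm
  filter_upwards [hnorm] with x hx
  simpa using hx

theorem inner_toLp_eq_integral {α : Type*} [MeasurableSpace α] {μ : Measure α} {f : α → ℝ}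
    (hf : MemLp f 2 μ) (g : Lp ℝ 2 μ) : ⟪hf.toLp, g⟫_ℝ = ∫ x, f x * g x ∂μ := by
  rw [L2.inner_def]
  refine integral_congr_ae ?_
  filter_upwards [hf.coeFn_toLp] with x hx
  rw [hx, real_inner_eq_re_inner, RCLike.inner_apply', conj_trivial, RCLike.re_to_real]

theorem orthonormal_trig (hT : 0 < T) : Orthonormal ℝ fun n => (memLp_trig T n).toLp := by
  rw [orthonormal_iff_ite]
  intro n m
  rw [← integral_trig_mul_trig hT n m, inner_toLp_eq_integral]
  refine integral_congr_ae ?_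
  filter_upwards [(memLp_trig T m).coeFn_toLp] with x hx
  rw [hx]

/-- The functions `trig T n`, `n : ℤ`, as a Hilbert basis of the real `L²` space of a period. -/
def trigBasis (hT : 0 < T) : HilbertBasis ℤ ℝ (Lp ℝ 2 (volume.restrict (period T))) :=
  HilbertBasis.mkOfOrthogonalEqBot (orthonormal_trig hT) <| by
    refine (Submodule.eq_bot_iff _).2 fun f hf => ?_
    refine Lp.eq_zero_iff_ae_eq_zero.2
      (ae_eq_zero_of_integral_trig_eq_zero hT (Lp.memLp f) fun n => ?_)
    rw [← inner_toLp_eq_integral (memLp_trig T n)]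
    exact Submodule.inner_right_of_mem_orthogonal (Submodule.subset_span (mem_range_self n)) hf

theorem trigBasis_apply (hT : 0 < T) (n : ℤ) : trigBasis hT n = (memLp_trig T n).toLp := by
  rw [trigBasis, HilbertBasis.coe_mkOfOrthogonalEqBot]

end TrigonometricBasis

section Weight

variable {s T : ℝ}

theorem measurableSet_strip (T : ℝ) : MeasurableSet (strip T) :=
  measurableSet_Ioc.prod measurableSet_Ioi

theorem restrict_strip (T : ℝ) : (volume : Measure (ℝ × ℝ)).restrict (strip T) =
    (volume.restrict (period T)).prod (volume.restrict (Ioi 0)) :=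
  (Measure.prod_restrict _ _).symm

theorem measurable_weight_density (s : ℝ) :
    Measurable fun p : ℝ × ℝ => ENNReal.ofReal (p.2 ^ (1 - 2 * s)) := by fun_prop

theorem toReal_weight_density_smul (s : ℝ) (f : ℝ × ℝ → ℝ) {p : ℝ × ℝ} (hp : p ∈ strip T) :
    (ENNReal.ofReal (p.2 ^ (1 - 2 * s))).toReal • f p = p.2 ^ (1 - 2 * s) * f p := by
  rw [smul_eq_mul, ENNReal.toReal_ofReal (Real.rpow_nonneg (mem_Ioi.1 hp.2).le _)]

theorem integral_weight (s T : ℝ) (f : ℝ × ℝ → ℝ) :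
    ∫ p, f p ∂weight s T = ∫ p in strip T, p.2 ^ (1 - 2 * s) * f p := by
  rw [weight, integral_withDensity_eq_integral_toReal_smul (measurable_weight_density s)
    (ae_of_all _ fun _ => ENNReal.ofReal_lt_top)]
  exact setIntegral_congr_fun (measurableSet_strip T) fun p hp => toReal_weight_density_smul s f hp

theorem integrable_weight_iff (s T : ℝ) (f : ℝ × ℝ → ℝ) :
    Integrable f (weight s T) ↔ IntegrableOn (fun p => p.2 ^ (1 - 2 * s) * f p) (strip T) := by
  rw [weight, integrable_withDensity_iff_integrable_smul' (measurable_weight_density s)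
    (ae_of_all _ fun _ => ENNReal.ofReal_lt_top)]
  exact integrableOn_congr_fun (fun p hp => toReal_weight_density_smul s f hp)
    (measurableSet_strip T)

theorem absolutelyContinuous_weight (s T : ℝ) : volume.restrict (strip T) ≪ weight s T := by
  refine withDensity_absolutelyContinuous' (measurable_weight_density s).aemeasurable ?_
  refine (ae_restrict_iff' (measurableSet_strip T)).2 (ae_of_all _ fun p hp => ?_)
  exact (ENNReal.ofReal_pos.2 (Real.rpow_pos_of_pos hp.2 _)).ne'

/-- `y ^ (2 s - 1) φ`: its inner product with `P` in the weighted `L²` space of the strip is the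
unweighted integral of `P φ`. -/
def stripDual (s : ℝ) (φ : ℝ × ℝ → ℝ) (p : ℝ × ℝ) : ℝ := p.2 ^ (2 * s - 1) * φ p

theorem measurable_stripDual {φ : ℝ × ℝ → ℝ} (hφ : Measurable φ) (s : ℝ) :
    Measurable (stripDual s φ) := by
  unfold stripDual; fun_prop

theorem weight_mul_mul_stripDual (s : ℝ) (P φ : ℝ × ℝ → ℝ) {p : ℝ × ℝ} (hp : p ∈ strip T) :
    p.2 ^ (1 - 2 * s) * (P p * stripDual s φ p) = P p * φ p := by
  have hcancel : p.2 ^ (1 - 2 * s) * p.2 ^ (2 * s - 1) = 1 := by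
    rw [← Real.rpow_add hp.2, sub_add_sub_cancel, sub_self, Real.rpow_zero]
  rw [stripDual, mul_left_comm, ← mul_assoc (p.2 ^ _), hcancel, one_mul]

theorem integral_mul_stripDual (s T : ℝ) (P φ : ℝ × ℝ → ℝ) :
    ∫ p, P p * stripDual s φ p ∂weight s T = ∫ p in strip T, P p * φ p := by
  rw [integral_weight]
  exact setIntegral_congr_fun (measurableSet_strip T) fun p hp =>
    weight_mul_mul_stripDual s P φ hp

theorem integrable_mul_stripDual_iff (s T : ℝ) (P φ : ℝ × ℝ → ℝ) :
    Integrable (fun p => P p * stripDual s φ p) (weight s T) ↔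
      IntegrableOn (fun p => P p * φ p) (strip T) := by
  rw [integrable_weight_iff]
  exact integrableOn_congr_fun (fun p hp => weight_mul_mul_stripDual s P φ hp)
    (measurableSet_strip T)

theorem integrable_indicator_rpow (hs : 0 < s) (R T : ℝ) :
    Integrable (fun p : ℝ × ℝ => (Ioc 0 R).indicator (fun y => y ^ (2 * s - 1)) p.2)
      (volume.restrict (strip T)) := by
  rw [restrict_strip]
  refine Integrable.comp_snd ((integrable_indicator_iff measurableSet_Ioc).2 ?_).restrict _
  rcases le_total 0 R with hR | hR
  · rw [← intervalIntegrable_iff_integrableOn_Ioc_of_le hR]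
    exact intervalIntegral.intervalIntegrable_rpow' (by linarith)
  · simp [Ioc_eq_empty_of_le hR]

theorem integral_indicator_rpow (hs : 0 < s) (hT : 0 < T) {R : ℝ} (hR : 0 ≤ R) :
    ∫ p in strip T, (Ioc 0 R).indicator (fun y => y ^ (2 * s - 1)) p.2 =
      T * (R ^ (2 * s) / (2 * s)) := by
  rw [restrict_strip, integral_fun_snd (f := (Ioc 0 R).indicator fun y => y ^ (2 * s - 1)),
    setIntegral_indicator measurableSet_Ioc, inter_eq_self_of_subset_right Ioc_subset_Ioi_self,
    ← intervalIntegral.integral_of_le hR, integral_rpow (Or.inl (by linarith)),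
    sub_add_cancel, Real.zero_rpow (by positivity), sub_zero, smul_eq_mul]
  simp [period, hT.le]

theorem stripDual_mul_self_le {φ : ℝ × ℝ → ℝ} {M R : ℝ} (hM : ∀ p ∈ strip T, |φ p| ≤ M)
    (hφ : ∀ p : ℝ × ℝ, R < p.2 → φ p = 0) {p : ℝ × ℝ} (hp : p ∈ strip T) :
    stripDual s φ p * φ p ≤ M ^ 2 * (Ioc 0 R).indicator (fun y => y ^ (2 * s - 1)) p.2 := by
  rcases le_or_gt p.2 R with h | h
  · rw [indicator_of_mem (mem_Ioc.2 ⟨hp.2, h⟩), stripDual, mul_assoc, ← sq, mul_comm]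
    exact mul_le_mul_of_nonneg_right (sq_le_sq.2 ((hM p hp).trans (le_abs_self M)))
      (Real.rpow_nonneg (mem_Ioi.1 hp.2).le _)
  · rw [hφ p h, mul_zero, indicator_of_notMem fun hmem => not_lt_of_ge hmem.2 h, mul_zero]

theorem memLp_stripDual (hs : 0 < s) {φ : ℝ × ℝ → ℝ} (hφm : Measurable φ) {M R : ℝ}
    (hM : ∀ p ∈ strip T, |φ p| ≤ M) (hφ : ∀ p : ℝ × ℝ, R < p.2 → φ p = 0) :
    MemLp (stripDual s φ) 2 (weight s T) := by
  have hm := measurable_stripDual hφm s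
  simp only [memLp_two_iff_integrable_sq hm.aestronglyMeasurable, sq]
  rw [integrable_mul_stripDual_iff]
  refine ((integrable_indicator_rpow hs R T).const_mul (M ^ 2)).mono' (by fun_prop) ?_
  refine (ae_restrict_iff' (measurableSet_strip T)).2 (ae_of_all _ fun p hp => ?_)
  have hnonneg : 0 ≤ stripDual s φ p * φ p := by
    rw [stripDual, mul_assoc]
    exact mul_nonneg (Real.rpow_nonneg (mem_Ioi.1 hp.2).le _) (mul_self_nonneg _)
  rw [Real.norm_of_nonneg hnonneg]
  exact stripDual_mul_self_le hM hφ hp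

theorem inner_stripDual_toLp {φ : ℝ × ℝ → ℝ} (hφ : MemLp (stripDual s φ) 2 (weight s T))
    (P : Lp ℝ 2 (weight s T)) : ⟪hφ.toLp, P⟫_ℝ = ∫ p in strip T, P p * φ p := by
  rw [inner_toLp_eq_integral, ← integral_mul_stripDual s]
  simp only [mul_comm]

theorem inner_stripDual_stripDual {φ ψ : ℝ × ℝ → ℝ} (hφ : MemLp (stripDual s φ) 2 (weight s T))
    (hψ : MemLp (stripDual s ψ) 2 (weight s T)) :
    ⟪hφ.toLp, hψ.toLp⟫_ℝ = ∫ p in strip T, stripDual s φ p * ψ p := by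
  rw [inner_toLp_eq_integral, ← integral_mul_stripDual]
  refine integral_congr_ae ?_
  filter_upwards [hψ.coeFn_toLp] with p hp
  rw [hp]

theorem norm_stripDual_toLp_sq_le (hs : 0 < s) (hT : 0 < T) {φ : ℝ × ℝ → ℝ}
    {M R : ℝ} (hR : 0 ≤ R) (hM : ∀ p ∈ strip T, |φ p| ≤ M)
    (hφ : ∀ p : ℝ × ℝ, R < p.2 → φ p = 0) (hL : MemLp (stripDual s φ) 2 (weight s T)) :
    ‖hL.toLp‖ ^ 2 ≤ M ^ 2 * (T * (R ^ (2 * s) / (2 * s))) := by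
  rw [← real_inner_self_eq_norm_sq, inner_stripDual_stripDual,
    ← integral_indicator_rpow hs hT hR, ← integral_const_mul]
  exact setIntegral_mono_on ((integrable_mul_stripDual_iff s T _ _).1 (hL.integrable_mul hL))
    ((integrable_indicator_rpow hs R T).const_mul (M ^ 2))
    (measurableSet_strip T) fun p hp => stripDual_mul_self_le hM hφ hp

end Weight

section Tests

variable {s T : ℝ} {φ : ℝ × ℝ → ℝ}

theorem IsTest.continuous (h : IsTest T φ) : Continuous φ := h.smooth.continuous

theorem IsTest.differentiable (h : IsTest T φ) : Differentiable ℝ φ :=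
  h.smooth.differentiable (by simp)

theorem IsTest.fderiv_apply (h : IsTest T φ) (v : ℝ × ℝ) :
    IsTest T fun p => fderiv ℝ φ p v where
  smooth := (h.smooth.fderiv_right (by simp)).clm_apply contDiff_const
  periodic x y := by
    have hshift : (fun p : ℝ × ℝ => φ (p + (T, 0))) = φ := by
      ext ⟨x, y⟩; simpa using h.periodic x y
    have := fderiv_comp_add_right (𝕜 := ℝ) (f := φ) (x := (x, y)) (T, 0)
    rw [hshift, Prod.mk_add_mk, add_zero] at this
    rw [this]
  support := by
    obtain ⟨R, hR⟩ := h.support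
    refine ⟨R + 1, fun x y hy => ?_⟩
    have hopen : IsOpen {p : ℝ × ℝ | R < |p.2|} := isOpen_lt continuous_const (by fun_prop)
    have hzero : φ =ᶠ[𝓝 (x, y)] fun _ => 0 := by
      filter_upwards [hopen.mem_nhds (show R < |y| by linarith)] with p hp
      exact hR p.1 p.2 (le_of_lt hp)
    rw [hzero.fderiv_eq, fderiv_fun_const, Pi.zero_apply, zero_apply]

theorem IsTest.fderiv_fderiv_comm (h : IsTest T φ) (p v w : ℝ × ℝ) :
    fderiv ℝ (fun q => fderiv ℝ φ q v) p w = fderiv ℝ (fun q => fderiv ℝ φ q w) p v := by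
  have hC2 : ContDiffAt ℝ 2 φ p := (contDiff_infty.1 h.smooth 2).contDiffAt
  have hdiff : DifferentiableAt ℝ (fderiv ℝ φ) p :=
    (hC2.fderiv_right (m := 1) le_rfl).differentiableAt one_ne_zero
  have happly (v w : ℝ × ℝ) :
      fderiv ℝ (fun q => fderiv ℝ φ q v) p w = fderiv ℝ (fderiv ℝ φ) p w v := by
    rw [fderiv_clm_apply hdiff (differentiableAt_const v)]
    simp
  rw [happly, happly]
  exact hC2.isSymmSndFDerivAt (by simp) w v

theorem IsTest.exists_bound (h : IsTest T φ) :
    ∃ M R : ℝ, 0 < R ∧ (∀ x ∈ period T, ∀ y, |φ (x, y)| ≤ M) ∧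
      ∀ x y, R ≤ |y| → φ (x, y) = 0 := by
  obtain ⟨R, hR⟩ := h.support
  obtain ⟨M, hM⟩ := ((isCompact_Icc (a := -(T / 2)) (b := T / 2)).prod
    (isCompact_Icc (a := -R) (b := R))).exists_bound_of_continuousOn h.continuous.continuousOn
  refine ⟨max M 0, max R 1, by positivity, fun x hx y => ?_, fun x y hy =>
    hR x y ((le_max_left _ _).trans hy)⟩
  rcases le_or_gt R |y| with hy | hy
  · rw [hR x y hy, abs_zero]
    exact le_max_right _ _
  · exact (hM (x, y) ⟨⟨hx.1.le, hx.2⟩, abs_le.1 hy.le⟩).trans (le_max_left _ _)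

theorem IsTest.memLp_trace (h : IsTest T φ) :
    MemLp (fun x => φ (x, 0)) 2 (volume.restrict (period T)) := by
  obtain ⟨M, R, -, hM, -⟩ := h.exists_bound
  exact MemLp.of_bound (h.continuous.comp (by fun_prop)).aestronglyMeasurable M
    ((ae_restrict_iff' measurableSet_Ioc).2 (ae_of_all _ fun x hx => hM x hx 0))

theorem IsTest.memLp_stripDual (h : IsTest T φ) (hs : 0 < s) :
    MemLp (stripDual s φ) 2 (weight s T) := by
  obtain ⟨M, R, -, hM, h0⟩ := h.exists_bound
  exact PeriodicFractional.memLp_stripDual hs h.continuous.measurable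
    (fun p hp => hM p.1 hp.1 p.2) fun p hp => h0 p.1 p.2 (hp.le.trans (le_abs_self _))

end Tests

section EnergySpace

variable {s T : ℝ}

/-- `(P, Q)` is curl free in the half-strip and its tangential component on `y = 0` is `u'`, weakly.
For `u` and `(P, Q)` square integrable this says that `(P, Q)` is the gradient of a function with
trace `u`. -/
def IsTraceGradient (T : ℝ) (u : ℝ → ℝ) (P Q : ℝ × ℝ → ℝ) : Prop :=
  ∀ φ, IsTest T φ →
    (∫ x in period T, u x * fderiv ℝ φ (x, 0) (1, 0)) + ∫ p in strip T, Q p * fderiv ℝ φ p (1, 0) =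
      ∫ p in strip T, P p * fderiv ℝ φ p (0, 1)

theorem isTraceGradient_congr_ae {u u' : ℝ → ℝ} {P P' Q Q' : ℝ × ℝ → ℝ}
    (hu : u =ᵐ[volume.restrict (period T)] u') (hP : P =ᵐ[weight s T] P')
    (hQ : Q =ᵐ[weight s T] Q') : IsTraceGradient T u P Q ↔ IsTraceGradient T u' P' Q' := by
  have hac := absolutelyContinuous_weight s T
  refine forall₂_congr fun φ _ => ?_
  have hu' : ∫ x in period T, u x * fderiv ℝ φ (x, 0) (1, 0) =
      ∫ x in period T, u' x * fderiv ℝ φ (x, 0) (1, 0) :=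
    integral_congr_ae (hu.mono fun x hx => congrArg (· * _) hx)
  have hP' : ∫ p in strip T, P p * fderiv ℝ φ p (0, 1) =
      ∫ p in strip T, P' p * fderiv ℝ φ p (0, 1) :=
    integral_congr_ae ((hac.ae_eq hP).mono fun p hp => congrArg (· * _) hp)
  have hQ' : ∫ p in strip T, Q p * fderiv ℝ φ p (1, 0) =
      ∫ p in strip T, Q' p * fderiv ℝ φ p (1, 0) :=
    integral_congr_ae ((hac.ae_eq hQ).mono fun p hp => congrArg (· * _) hp)
  rw [hu', hP', hQ']

theorem MemEnergy.isTraceGradient {U P Q : ℝ × ℝ → ℝ} (h : MemEnergy s T U P Q) :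
    IsTraceGradient T (fun x => U (x, 0)) P Q := fun φ hφ => by
  have hdx := h.weak_dx _ (hφ.fderiv_apply (0, 1))
  have hdy := h.weak_dy _ (hφ.fderiv_apply (1, 0))
  simp only [hφ.fderiv_fderiv_comm _ (1, 0) (0, 1)] at hdy
  linarith

/-- The real `L²` space of a period. -/
abbrev TraceSpace (T : ℝ) := Lp ℝ 2 (volume.restrict (period T))

/-- The weighted `L²` space of the strip, containing the components of gradients. -/
abbrev GradSpace (s T : ℝ) := Lp ℝ 2 (weight s T)

/-- Triples of a boundary function and the two components of a vector field, with the Hilbert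
space structure of the product. -/
abbrev Triple (s T : ℝ) := WithLp 2 (TraceSpace T × WithLp 2 (GradSpace s T × GradSpace s T))

/-- The triple whose inner product with `(u, P, Q)` vanishes exactly if `φ` satisfies the identity
in the definition of `IsTraceGradient`. -/
def curlConstraint (hs : 0 < s) {φ : ℝ × ℝ → ℝ} (hφ : IsTest T φ) : Triple s T :=
  WithLp.toLp 2 ((hφ.fderiv_apply (1, 0)).memLp_trace.toLp,
    WithLp.toLp 2 (-((hφ.fderiv_apply (0, 1)).memLp_stripDual hs).toLp,
      ((hφ.fderiv_apply (1, 0)).memLp_stripDual hs).toLp))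

/-- The Hilbert space of functions of finite energy, represented by the triple of the trace and the
two components of the weak gradient. -/
def energySpace (T : ℝ) (hs : 0 < s) : Submodule ℝ (Triple s T) :=
  (Submodule.span ℝ (range fun φ : {φ // IsTest T φ} => curlConstraint hs φ.2))ᗮ

instance (hs : 0 < s) : CompleteSpace (energySpace T hs) := by
  unfold energySpace; infer_instance

theorem inner_curlConstraint (hs : 0 < s) {φ : ℝ × ℝ → ℝ} (hφ : IsTest T φ) (z : Triple s T) :
    ⟪curlConstraint hs hφ, z⟫_ℝ = (∫ x in period T, z.fst x * fderiv ℝ φ (x, 0) (1, 0)) +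
      (-(∫ p in strip T, z.snd.fst p * fderiv ℝ φ p (0, 1)) +
        ∫ p in strip T, z.snd.snd p * fderiv ℝ φ p (1, 0)) := by
  rw [← inner_stripDual_toLp ((hφ.fderiv_apply (1, 0)).memLp_stripDual hs),
    ← inner_stripDual_toLp ((hφ.fderiv_apply (0, 1)).memLp_stripDual hs), ← inner_neg_left]
  simp only [mul_comm (z.fst _)]
  rw [← inner_toLp_eq_integral (hφ.fderiv_apply (1, 0)).memLp_trace]
  rfl

theorem mem_energySpace_iff (hs : 0 < s) (z : Triple s T) :
    z ∈ energySpace T hs ↔ IsTraceGradient T z.fst z.snd.fst z.snd.snd := by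
  have hrange : z ∈ energySpace T hs ↔
      ∀ φ (hφ : IsTest T φ), ⟪curlConstraint hs hφ, z⟫_ℝ = 0 := by
    rw [energySpace, ← Submodule.span_singleton_le_iff_mem, ← Submodule.isOrtho_iff_le,
      Submodule.isOrtho_comm, Submodule.isOrtho_span]
    simp only [forall_mem_range, mem_singleton_iff, forall_eq, Subtype.forall]
  rw [hrange]
  refine forall₂_congr fun φ hφ => ?_
  rw [inner_curlConstraint]
  constructor <;> intro h <;> linarith

/-- The element of the energy space with given trace and weak gradient. -/
def IsTraceGradient.toEnergySpace {u : ℝ → ℝ} {P Q : ℝ × ℝ → ℝ} (h : IsTraceGradient T u P Q)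
    (hs : 0 < s) (hu : MemLp u 2 (volume.restrict (period T))) (hP : MemLp P 2 (weight s T))
    (hQ : MemLp Q 2 (weight s T)) : energySpace T hs :=
  ⟨WithLp.toLp 2 (hu.toLp, WithLp.toLp 2 (hP.toLp, hQ.toLp)), (mem_energySpace_iff hs _).2 <|
    (isTraceGradient_congr_ae hu.coeFn_toLp hP.coeFn_toLp hQ.coeFn_toLp).2 h⟩

/-- The element of the energy space given by a function of finite energy. -/
def MemEnergy.toEnergySpace {U P Q : ℝ × ℝ → ℝ} (h : MemEnergy s T U P Q) (hs : 0 < s) :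
    energySpace T hs :=
  h.isTraceGradient.toEnergySpace hs h.trace_mem.memLp h.memLp_dx h.memLp_dy

/-- The trace on `y = 0`. -/
def traceMap (T : ℝ) (hs : 0 < s) : energySpace T hs →L[ℝ] TraceSpace T :=
  (WithLp.fstL 2 ℝ _ _).comp (energySpace T hs).subtypeL

/-- The weak derivative in `x`. -/
def dxMap (T : ℝ) (hs : 0 < s) : energySpace T hs →L[ℝ] GradSpace s T :=
  ((WithLp.fstL 2 ℝ _ _).comp (WithLp.sndL 2 ℝ _ _)).comp (energySpace T hs).subtypeL

/-- The weak derivative in `y`. -/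
def dyMap (T : ℝ) (hs : 0 < s) : energySpace T hs →L[ℝ] GradSpace s T :=
  ((WithLp.sndL 2 ℝ _ _).comp (WithLp.sndL 2 ℝ _ _)).comp (energySpace T hs).subtypeL

variable {hs : 0 < s}

theorem isTraceGradient_of_energySpace (h : energySpace T hs) :
    IsTraceGradient T (traceMap T hs h) (dxMap T hs h) (dyMap T hs h) :=
  (mem_energySpace_iff hs h.1).1 h.2

theorem norm_sq_energySpace (h : energySpace T hs) :
    ‖h‖ ^ 2 = ‖traceMap T hs h‖ ^ 2 + (‖dxMap T hs h‖ ^ 2 + ‖dyMap T hs h‖ ^ 2) := by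
  rw [Submodule.coe_norm, WithLp.prod_norm_sq_eq_of_L2, WithLp.prod_norm_sq_eq_of_L2]
  rfl

end EnergySpace

section Compactness

variable {s T M : ℝ} {ψ : ℝ → ℝ}

theorem fderiv_mul_separated {f g : ℝ → ℝ} {f' g' : ℝ} {p : ℝ × ℝ} (hf : HasDerivAt f f' p.1)
    (hg : HasDerivAt g g' p.2) :
    fderiv ℝ (fun p : ℝ × ℝ => f p.1 * g p.2) p (1, 0) = f' * g p.2 ∧
      fderiv ℝ (fun p : ℝ × ℝ => f p.1 * g p.2) p (0, 1) = f p.1 * g' := by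
  have hf' := hf.comp_hasFDerivAt p (hasFDerivAt_fst (𝕜 := ℝ) (E := ℝ) (F := ℝ))
  have hg' := hg.comp_hasFDerivAt p (hasFDerivAt_snd (𝕜 := ℝ) (E := ℝ) (F := ℝ))
  have hfg : fderiv ℝ (fun p : ℝ × ℝ => f p.1 * g p.2) p = _ := (hf'.mul hg').fderiv
  rw [hfg]
  constructor <;> simp [mul_comm]

/-- A measurable function on the line that is bounded by `M` and vanishes outside `(-1, 1)`: the
vertical profile of the functions `layer` below. -/
structure IsProfile (M : ℝ) (ψ : ℝ → ℝ) : Prop where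
  measurable : Measurable ψ
  abs_le : ∀ y, |ψ y| ≤ M
  eq_zero : ∀ y, 1 ≤ |y| → ψ y = 0

theorem exists_cutoff : ∃ χ : ℝ → ℝ, ∃ M : ℝ, ContDiff ℝ ∞ χ ∧ χ 0 = 1 ∧
    IsProfile M χ ∧ IsProfile M (deriv χ) := by
  let b : ContDiffBump (0 : ℝ) := ⟨1 / 4, 1 / 2, by norm_num, by norm_num⟩
  have hb : ContDiff ℝ ∞ b := b.contDiff
  have hderiv : Continuous (deriv b) := hb.continuous_deriv (by simp)
  obtain ⟨M, hM⟩ := b.hasCompactSupport.exists_bound_of_continuous hb.continuous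
  obtain ⟨M', hM'⟩ := b.hasCompactSupport.deriv.exists_bound_of_continuous hderiv
  have hsupp (y : ℝ) (hy : 1 ≤ |y|) : y ∉ tsupport b := by
    rw [b.tsupport_eq, Metric.mem_closedBall, dist_zero_right, Real.norm_eq_abs, not_le]
    exact lt_of_lt_of_le one_half_lt_one hy
  exact ⟨b, max M M', hb, b.one_of_mem_closedBall (Metric.mem_closedBall_self b.rIn_pos.le),
    ⟨hb.continuous.measurable, fun y => (hM y).trans (le_max_left _ _), fun y hy =>
      image_eq_zero_of_notMem_tsupport (hsupp y hy)⟩,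
    ⟨hderiv.measurable, fun y => (hM' y).trans (le_max_right _ _), fun y hy =>
      image_eq_zero_of_notMem_tsupport fun hmem => hsupp y hy (tsupport_deriv_subset hmem)⟩⟩

/-- The trigonometric function of frequency `m` times `ψ ((|n| + 1) y)`. For a cutoff `ψ` and
`m = n` it is concentrated where a function of finite energy with trace of frequency `n` lives. -/
def layer (T : ℝ) (ψ : ℝ → ℝ) (m n : ℤ) (p : ℝ × ℝ) : ℝ :=
  trig T m p.1 * ψ ((|(n : ℝ)| + 1) * p.2)

theorem IsProfile.layer_eq_zero (hψ : IsProfile M ψ) (m n : ℤ) {p : ℝ × ℝ}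
    (hp : 1 / (|(n : ℝ)| + 1) ≤ |p.2|) : layer T ψ m n p = 0 := by
  have hpos : (0 : ℝ) < |(n : ℝ)| + 1 := by positivity
  rw [layer, hψ.eq_zero, mul_zero]
  rwa [abs_mul, abs_of_pos hpos, ← div_le_iff₀' hpos]

theorem IsProfile.abs_layer_le (hψ : IsProfile M ψ) (m n : ℤ) (p : ℝ × ℝ) :
    |layer T ψ m n p| ≤ 2 / √T * M := by
  rw [layer, abs_mul]
  exact mul_le_mul (abs_trig_le T m _) (hψ.abs_le _) (abs_nonneg _) (by positivity)

theorem IsProfile.memLp_layer (hψ : IsProfile M ψ) (hs : 0 < s) (T : ℝ) (m n : ℤ) :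
    MemLp (stripDual s (layer T ψ m n)) 2 (weight s T) := by
  have hψm := hψ.measurable
  have htrig := (continuous_trig T m).measurable
  exact memLp_stripDual hs (by unfold layer; fun_prop) (fun p _ => hψ.abs_layer_le m n p)
    fun p hp => hψ.layer_eq_zero m n (hp.le.trans (le_abs_self _))

/-- The vector whose inner product with `P` is the unweighted integral of `P` against
`layer T ψ m n`. -/
def IsProfile.layerVec (hψ : IsProfile M ψ) (hs : 0 < s) (T : ℝ) (m n : ℤ) : GradSpace s T :=
  (hψ.memLp_layer hs T m n).toLp

theorem IsProfile.inner_layerVec (hψ : IsProfile M ψ) (hs : 0 < s) (m n : ℤ) (P : GradSpace s T) :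
    ⟪hψ.layerVec hs T m n, P⟫_ℝ = ∫ p in strip T, P p * layer T ψ m n p :=
  inner_stripDual_toLp _ P

theorem IsProfile.norm_layerVec_sq_le (hψ : IsProfile M ψ) (hs : 0 < s) (hT : 0 < T) (m n : ℤ) :
    ‖hψ.layerVec hs T m n‖ ^ 2 ≤ 2 * M ^ 2 / s * (1 / (|(n : ℝ)| + 1)) ^ (2 * s) := by
  refine (norm_stripDual_toLp_sq_le hs hT (R := 1 / (|(n : ℝ)| + 1)) (by positivity)
    (fun p _ => hψ.abs_layer_le m n p) (fun p hp =>
      hψ.layer_eq_zero m n (hp.le.trans (le_abs_self _))) _).trans_eq ?_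
  rw [mul_pow, div_pow, Real.sq_sqrt hT.le]
  field_simp

theorem IsProfile.inner_layerVec_eq_zero (hψ : IsProfile M ψ) (hs : 0 < s) (hT : 0 < T)
    {m m' : ℤ} (hne : m ≠ m') (n n' : ℤ) :
    ⟪hψ.layerVec hs T m n, hψ.layerVec hs T m' n'⟫_ℝ = 0 := by
  have hsep (p : ℝ × ℝ) : stripDual s (layer T ψ m n) p * layer T ψ m' n' p =
      (trig T m p.1 * trig T m' p.1) * (p.2 ^ (2 * s - 1) *
        (ψ ((|(n : ℝ)| + 1) * p.2) * ψ ((|(n' : ℝ)| + 1) * p.2))) := by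
    simp only [stripDual, layer]; ring
  rw [layerVec, layerVec, inner_stripDual_stripDual, restrict_strip]
  simp only [hsep]
  rw [integral_prod_mul (fun x => trig T m x * trig T m' x) fun y => y ^ (2 * s - 1) *
    (ψ ((|(n : ℝ)| + 1) * y) * ψ ((|(n' : ℝ)| + 1) * y)), integral_trig_mul_trig hT, if_neg hne,
    zero_mul]

theorem IsProfile.sum_inner_layerVec_sq_le (hψ : IsProfile M ψ) (hs : 0 < s) (hT : 0 < T)
    {f : ℤ → ℤ} (hf : f.Injective) {t : Finset ℤ} {N : ℝ} (hN : 0 ≤ N)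
    (ht : ∀ n ∈ t, N ≤ |(n : ℝ)|) (P : GradSpace s T) :
    ∑ n ∈ t, ⟪hψ.layerVec hs T (f n) n, P⟫_ℝ ^ 2 ≤
      2 * M ^ 2 / s * (1 / (N + 1)) ^ (2 * s) * ‖P‖ ^ 2 := by
  have hnonneg : 0 ≤ 2 * M ^ 2 / s * (1 / (N + 1)) ^ (2 * s) := by positivity
  rw [← Real.sq_sqrt hnonneg]
  refine sum_inner_sq_le_of_orthogonal (fun n => hψ.layerVec hs T (f n) n) t
    (fun n hn => Real.le_sqrt_of_sq_le ((hψ.norm_layerVec_sq_le hs hT _ _).trans ?_))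
    (fun i _ j _ hij => hψ.inner_layerVec_eq_zero hs hT (hf.ne hij) _ _) P
  have := ht n hn
  gcongr

theorem isTest_layer (hT : 0 < T) (hψ : ContDiff ℝ ∞ ψ) (hprof : IsProfile M ψ) (m n : ℤ) :
    IsTest T (layer T ψ m n) where
  smooth := by
    have := contDiff_trig T m
    unfold layer; fun_prop
  periodic x y := by simp only [layer, trig_periodic hT m x]
  support := ⟨1 / (|(n : ℝ)| + 1), fun x y hy => hprof.layer_eq_zero m n (p := (x, y)) hy⟩

theorem fderiv_layer (hψ : Differentiable ℝ ψ) (m n : ℤ) (p : ℝ × ℝ) :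
    fderiv ℝ (layer T ψ m n) p (1, 0) = 2 * Real.pi * m / T * layer T ψ (-m) n p ∧
      fderiv ℝ (layer T ψ m n) p (0, 1) = (|(n : ℝ)| + 1) * layer T (deriv ψ) m n p := by
  have hvert : HasDerivAt (fun y => ψ ((|(n : ℝ)| + 1) * y))
      (deriv ψ ((|(n : ℝ)| + 1) * p.2) * (|(n : ℝ)| + 1)) p.2 := by
    refine (hψ _).hasDerivAt.comp p.2 ?_
    simpa using (hasDerivAt_id p.2).const_mul (|(n : ℝ)| + 1)
  obtain ⟨hdx, hdy⟩ := fderiv_mul_separated (hasDerivAt_trig T m p.1) hvert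
  refine ⟨Eq.trans hdx ?_, Eq.trans hdy ?_⟩ <;> rw [layer] <;> ring

theorem trigBasis_inner_traceMap_add (hs : 0 < s) (hT : 0 < T) {χ : ℝ → ℝ} (hχ : ContDiff ℝ ∞ χ)
    (hχ0 : χ 0 = 1) (hprof : IsProfile M χ) (hprof' : IsProfile M (deriv χ)) (n : ℤ)
    (h : energySpace T hs) :
    2 * Real.pi * n / T *
        (⟪trigBasis hT n, traceMap T hs h⟫_ℝ + ⟪hprof.layerVec hs T n n, dyMap T hs h⟫_ℝ) =
      -((|(n : ℝ)| + 1) * ⟪hprof'.layerVec hs T (-n) n, dxMap T hs h⟫_ℝ) := by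
  have hgrad := isTraceGradient_of_energySpace h _ (isTest_layer hT hχ hprof (-n) n)
  have htrace (x : ℝ) : layer T χ n n (x, 0) = trig T n x := by
    rw [layer, mul_zero, hχ0, mul_one]
  have hderiv := fderiv_layer (T := T) (hχ.differentiable (by simp)) (-n) n
  simp only [fun p => (hderiv p).1, fun p => (hderiv p).2, neg_neg, htrace,
    mul_left_comm _ (2 * Real.pi * _ / T), mul_left_comm _ (|(n : ℝ)| + 1),
    integral_const_mul] at hgrad
  rw [trigBasis_apply, inner_toLp_eq_integral, IsProfile.inner_layerVec, IsProfile.inner_layerVec,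
    ← hgrad]
  simp only [mul_comm (trig T n _)]
  push_cast
  ring

theorem trigBasis_inner_traceMap_sq_le (hs : 0 < s) (hT : 0 < T) {χ : ℝ → ℝ}
    (hχ : ContDiff ℝ ∞ χ) (hχ0 : χ 0 = 1) (hprof : IsProfile M χ) (hprof' : IsProfile M (deriv χ))
    {n : ℤ} (hn : n ≠ 0) (h : energySpace T hs) :
    ⟪trigBasis hT n, traceMap T hs h⟫_ℝ ^ 2 ≤
      2 * ⟪hprof.layerVec hs T n n, dyMap T hs h⟫_ℝ ^ 2 +
        2 * ((T / Real.pi) ^ 2 * ⟪hprof'.layerVec hs T (-n) n, dxMap T hs h⟫_ℝ ^ 2) := by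
  have hidentity := trigBasis_inner_traceMap_add hs hT hχ hχ0 hprof hprof' n h
  set a := ⟪trigBasis hT n, traceMap T hs h⟫_ℝ
  set q := ⟪hprof.layerVec hs T n n, dyMap T hs h⟫_ℝ
  set b := ⟪hprof'.layerVec hs T (-n) n, dxMap T hs h⟫_ℝ
  have hn1 : (1 : ℝ) ≤ |(n : ℝ)| := mod_cast Int.one_le_abs hn
  have hn0 : (n : ℝ) ≠ 0 := Int.cast_ne_zero.2 hn
  have hsum : a + q = -((|(n : ℝ)| + 1) / (2 * n) * (T / Real.pi * b)) := by
    field_simp at hidentity ⊢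
    linarith
  have hratio : ((|(n : ℝ)| + 1) / (2 * n)) ^ 2 ≤ 1 := by
    rw [div_pow, mul_pow, ← sq_abs (n : ℝ), div_le_one (by positivity)]
    nlinarith
  have hsq : (a + q) ^ 2 ≤ (T / Real.pi) ^ 2 * b ^ 2 := by
    rw [hsum, neg_sq, mul_pow, mul_pow (T / Real.pi)]
    exact mul_le_of_le_one_left (by positivity) hratio
  linarith [sq_nonneg (a + 2 * q)]

theorem exists_sum_sq_inner_traceMap_le (hs : 0 < s) (hT : 0 < T) :
    ∃ C : ℝ, ∀ (N : ℕ) (h : energySpace T hs) (t : Finset ℤ),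
      (∀ n ∈ t, (N : ℝ) ≤ |(n : ℝ)| ∧ n ≠ 0) →
      ∑ n ∈ t, ⟪trigBasis hT n, traceMap T hs h⟫_ℝ ^ 2 ≤
        C * (1 / ((N : ℝ) + 1)) ^ (2 * s) * ‖h‖ ^ 2 := by
  obtain ⟨χ, M, hχ, hχ0, hprof, hprof'⟩ := exists_cutoff
  refine ⟨2 * (1 + (T / Real.pi) ^ 2) * (2 * M ^ 2 / s), fun N h t ht => ?_⟩
  have hdy := hprof.sum_inner_layerVec_sq_le hs hT Function.injective_id N.cast_nonneg
    (fun n hn => (ht n hn).1) (dyMap T hs h)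
  have hdx := hprof'.sum_inner_layerVec_sq_le hs hT neg_injective N.cast_nonneg
    (fun n hn => (ht n hn).1) (dxMap T hs h)
  set D := 2 * M ^ 2 / s * (1 / ((N : ℝ) + 1)) ^ (2 * s) with hD
  have hle_dy : ‖dyMap T hs h‖ ^ 2 ≤ ‖h‖ ^ 2 := by
    rw [norm_sq_energySpace]; linarith [sq_nonneg ‖traceMap T hs h‖, sq_nonneg ‖dxMap T hs h‖]
  have hle_dx : ‖dxMap T hs h‖ ^ 2 ≤ ‖h‖ ^ 2 := by
    rw [norm_sq_energySpace]; linarith [sq_nonneg ‖traceMap T hs h‖, sq_nonneg ‖dyMap T hs h‖]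
  calc ∑ n ∈ t, ⟪trigBasis hT n, traceMap T hs h⟫_ℝ ^ 2
      ≤ 2 * ∑ n ∈ t, ⟪hprof.layerVec hs T n n, dyMap T hs h⟫_ℝ ^ 2 +
        2 * ((T / Real.pi) ^ 2 *
          ∑ n ∈ t, ⟪hprof'.layerVec hs T (-n) n, dxMap T hs h⟫_ℝ ^ 2) := by
        simp only [Finset.mul_sum, ← Finset.sum_add_distrib]
        exact Finset.sum_le_sum fun n hn =>
          trigBasis_inner_traceMap_sq_le hs hT hχ hχ0 hprof hprof' (ht n hn).2 h
    _ ≤ 2 * (D * ‖h‖ ^ 2) + 2 * ((T / Real.pi) ^ 2 * (D * ‖h‖ ^ 2)) := by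
        have : 0 ≤ D := by positivity
        gcongr
        · exact hdy.trans (by gcongr)
        · exact hdx.trans (by gcongr)
    _ = _ := by rw [hD]; ring

theorem isCompactOperator_traceMap (hs : 0 < s) (hT : 0 < T) :
    IsCompactOperator (traceMap T hs) := by
  obtain ⟨C, hsum⟩ := exists_sum_sq_inner_traceMap_le hs hT
  refine isCompactOperator_of_hilbertBasis_tails (H := energySpace T hs) (trigBasis hT)
    (traceMap T hs) fun ε hε => ?_
  have hlim : Tendsto (fun N : ℕ => C * (1 / ((N : ℝ) + 1)) ^ (2 * s)) atTop (𝓝 0) := by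
    have := ((tendsto_one_div_add_atTop_nhds_zero_nat (𝕜 := ℝ)).rpow_const (p := 2 * s)
      (Or.inr (by positivity))).const_mul C
    rwa [Real.zero_rpow (by positivity), mul_zero] at this
  obtain ⟨N, hN⟩ := (hlim.eventually (gt_mem_nhds (by positivity : 0 < ε ^ 2))).exists
  refine ⟨Finset.Icc (-N) N, fun h t ht => (hsum N h t fun n hn => ?_).trans ?_⟩
  · have hn' : n ∉ Finset.Icc (-(N : ℤ)) N := Finset.disjoint_left.1 ht hn
    rw [Finset.mem_Icc, ← abs_le, not_le] at hn'
    exact ⟨mod_cast hn'.le, abs_pos.1 ((Int.natCast_nonneg N).trans_lt hn')⟩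
  · rw [mul_pow]
    gcongr

end Compactness

section Primitive

variable {T : ℝ} {φ : ℝ × ℝ → ℝ}

theorem integral_Ioi_eq_intervalIntegral {g : ℝ → ℝ} {R : ℝ} (hg : Continuous g)
    (hR : ∀ z, R ≤ z → g z = 0) (y : ℝ) : ∫ z in Ioi y, g z = ∫ z in y..R, g z := by
  have hzero : EqOn g (fun _ => 0) (Ioi R) := fun z hz => hR z (le_of_lt hz)
  rw [← intervalIntegral.integral_interval_add_Ioi' (hg.intervalIntegrable y R)
    (integrableOn_zero.congr_fun hzero.symm measurableSet_Ioi),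
    setIntegral_eq_zero_of_forall_eq_zero hzero, add_zero]

/-- The primitive `∫_y^∞ φ(x, z) dz` of a test function in the second variable, as a convolution. -/
def tailPrimitive (φ : ℝ × ℝ → ℝ) (p : ℝ × ℝ) : ℝ :=
  convolution ((Iic (0 : ℝ)).indicator fun _ => (1 : ℝ)) (fun y => φ (p.1, y))
    (ContinuousLinearMap.mul ℝ ℝ) volume p.2

theorem IsTest.tailPrimitive_eq (hφ : IsTest T φ) {R : ℝ} (hR : ∀ x y, R ≤ |y| → φ (x, y) = 0)
    (x y : ℝ) : tailPrimitive φ (x, y) = ∫ z in y..R, φ (x, z) := by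
  have hslice : Continuous fun z => φ (x, z) := hφ.continuous.comp (by fun_prop)
  rw [← integral_Ioi_eq_intervalIntegral hslice
      (fun z hz => hR x z (hz.trans (le_abs_self z))), ← integral_Ici_eq_integral_Ioi,
    tailPrimitive, convolution_eq_swap, ← integral_indicator measurableSet_Ici]
  congr 1 with z
  by_cases hz : y ≤ z <;> simp [hz]

theorem IsTest.contDiff_tailPrimitive (hφ : IsTest T φ) : ContDiff ℝ ∞ (tailPrimitive φ) := by
  obtain ⟨R, hR⟩ := hφ.support
  rw [← contDiffOn_univ, ← univ_prod_univ]
  refine contDiffOn_convolution_right_with_param (n := ⊤) (ContinuousLinearMap.mul ℝ ℝ)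
    (g := fun x y => φ (x, y)) (k := Icc (-R) R) isOpen_univ isCompact_Icc (fun x y _ hy => ?_)
    ((locallyIntegrable_const (1 : ℝ)).indicator measurableSet_Iic) hφ.smooth.contDiffOn
  rw [mem_Icc, ← abs_le, not_le] at hy
  exact hR x y hy.le

theorem hasDerivAt_vertical_slice {ψ : ℝ × ℝ → ℝ} (hψ : Differentiable ℝ ψ) (x y : ℝ) :
    HasDerivAt (fun y => ψ (x, y)) (fderiv ℝ ψ (x, y) (0, 1)) y :=
  (hψ (x, y)).hasFDerivAt.comp_hasDerivAt y ((hasDerivAt_const y x).prodMk (hasDerivAt_id y))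

theorem IsTest.fderiv_tailPrimitive (hφ : IsTest T φ) (p : ℝ × ℝ) :
    fderiv ℝ (tailPrimitive φ) p (0, 1) = -φ p := by
  obtain ⟨R, hR⟩ := hφ.support
  obtain ⟨x, y⟩ := p
  have hslice : Continuous fun z => φ (x, z) := hφ.continuous.comp (by fun_prop)
  have hderiv : HasDerivAt (fun y => tailPrimitive φ (x, y)) (-φ (x, y)) y := by
    simp only [hφ.tailPrimitive_eq hR]
    exact intervalIntegral.integral_hasDerivAt_left (hslice.intervalIntegrable _ _)
      (hslice.stronglyMeasurableAtFilter _ _) hslice.continuousAt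
  exact (hasDerivAt_vertical_slice
    (hφ.contDiff_tailPrimitive.differentiable (by simp)) x y).unique hderiv

/-- The tail primitive, cut off below `y = -1` to make it a test function. -/
def cutTailPrimitive (φ : ℝ × ℝ → ℝ) (p : ℝ × ℝ) : ℝ :=
  tailPrimitive φ p * Real.smoothTransition (p.2 + 2)

theorem isTest_cutTailPrimitive (hφ : IsTest T φ) : IsTest T (cutTailPrimitive φ) where
  smooth := hφ.contDiff_tailPrimitive.mul (Real.smoothTransition.contDiff.comp (by fun_prop))
  periodic x y := by
    obtain ⟨R, hR⟩ := hφ.support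
    simp only [cutTailPrimitive, hφ.tailPrimitive_eq hR, hφ.periodic]
  support := by
    obtain ⟨R, hR⟩ := hφ.support
    refine ⟨max R 2, fun x y hy => ?_⟩
    obtain ⟨hRy, hy2⟩ := max_le_iff.1 hy
    rcases le_abs'.1 hy2 with h | h
    · rw [cutTailPrimitive,
        Real.smoothTransition.zero_of_nonpos (by simpa using by linarith), mul_zero]
    · rw [abs_of_nonneg (by linarith)] at hRy
      rw [cutTailPrimitive, hφ.tailPrimitive_eq hR,
        intervalIntegral.integral_congr (g := fun _ => 0), intervalIntegral.integral_zero, zero_mul]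
      intro z hz
      rw [uIcc_of_ge hRy] at hz
      exact hR x z (hz.1.trans (le_abs_self z))

theorem fderiv_cutTailPrimitive (hφ : IsTest T φ) {p : ℝ × ℝ} (hp : 0 < p.2) :
    fderiv ℝ (cutTailPrimitive φ) p (0, 1) = -φ p := by
  have hopen : IsOpen {q : ℝ × ℝ | 0 < q.2} := isOpen_lt continuous_const continuous_snd
  have heq : cutTailPrimitive φ =ᶠ[𝓝 p] tailPrimitive φ := by
    filter_upwards [hopen.mem_nhds hp] with q (hq : 0 < q.2)
    rw [cutTailPrimitive, Real.smoothTransition.one_of_one_le (by linarith),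
      mul_one]
  rw [heq.fderiv_eq, hφ.fderiv_tailPrimitive]

end Primitive

section Box

variable {s T : ℝ} {Q : ℝ × ℝ → ℝ}

theorem measurableSet_box (T R : ℝ) : MeasurableSet (period T ×ˢ Ioc 0 R) :=
  measurableSet_Ioc.prod measurableSet_Ioc

theorem restrict_box (T R : ℝ) : (volume : Measure (ℝ × ℝ)).restrict (period T ×ˢ Ioc 0 R) =
    (volume.restrict (period T)).prod (volume.restrict (Ioc 0 R)) :=
  (Measure.prod_restrict _ _).symm

theorem box_subset_strip (T R : ℝ) : period T ×ˢ Ioc 0 R ⊆ strip T :=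
  prod_mono le_rfl Ioc_subset_Ioi_self

theorem setIntegral_strip_eq_box {f : ℝ × ℝ → ℝ} {R : ℝ} (hf : ∀ x y, R ≤ |y| → f (x, y) = 0) :
    ∫ p in strip T, f p = ∫ p in period T ×ˢ Ioc 0 R, f p := by
  refine setIntegral_eq_of_subset_of_forall_sdiff_eq_zero (measurableSet_strip T)
    (box_subset_strip T R) fun p hp => hf p.1 p.2 (le_abs.2 (Or.inl ?_))
  by_contra! hlt
  exact hp.2 ⟨hp.1.1, hp.1.2, hlt.le⟩

theorem integrableOn_box_of_memLp (hs : 0 < s) (hQ : MemLp Q 2 (weight s T)) (R : ℝ) :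
    IntegrableOn Q (period T ×ˢ Ioc 0 R) := by
  set φ : ℝ × ℝ → ℝ := {p : ℝ × ℝ | p.2 ≤ R}.indicator fun _ => 1
  have hφm : Measurable φ :=
    measurable_const.indicator (measurableSet_le measurable_snd measurable_const)
  have hφ : MemLp (stripDual s φ) 2 (weight s T) := by
    refine memLp_stripDual hs hφm (M := 1) (R := R) (fun p _ => ?_) fun p hp =>
      indicator_of_notMem (show p ∉ {p : ℝ × ℝ | p.2 ≤ R} from not_le.2 hp) _
    exact (norm_indicator_le_norm_self (fun _ => (1 : ℝ)) p).trans_eq norm_one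
  have hint : IntegrableOn (fun p => Q p * φ p) (strip T) :=
    (integrable_mul_stripDual_iff s T Q φ).1 (hQ.integrable_mul hφ)
  refine (hint.mono_set (box_subset_strip T R)).congr_fun (fun p hp => ?_) (measurableSet_box T R)
  simp only [φ, indicator_of_mem (show p ∈ {p : ℝ × ℝ | p.2 ≤ R} from hp.2.2), mul_one]

/-- The primitive of `Q` in the second variable that vanishes on `y = 0`. -/
def verticalPrimitive (Q : ℝ × ℝ → ℝ) (p : ℝ × ℝ) : ℝ := ∫ t in (0)..p.2, Q (p.1, t)

theorem verticalPrimitive_eq_integral_indicator (Q : ℝ × ℝ → ℝ) {R x y : ℝ} (hy : y ∈ Ioc 0 R) :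
    verticalPrimitive Q (x, y) = ∫ t in Ioc 0 R, (Iic y).indicator (fun t => Q (x, t)) t := by
  rw [verticalPrimitive, intervalIntegral.integral_of_le hy.1.le,
    setIntegral_indicator measurableSet_Iic, Ioc_inter_Iic, inf_eq_right.2 hy.2]

theorem integrableOn_verticalPrimitive {R : ℝ} (hQ : IntegrableOn Q (period T ×ˢ Ioc 0 R)) :
    IntegrableOn (verticalPrimitive Q) (period T ×ˢ Ioc 0 R) := by
  set μ := volume.restrict (period T)
  set ν := (volume : Measure ℝ).restrict (Ioc 0 R)
  rw [IntegrableOn, restrict_box] at hQ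
  have hmeas : AEStronglyMeasurable (fun p : ℝ × ℝ => ∫ t, (Iic p.2).indicator
      (fun t => Q (p.1, t)) t ∂ν) (μ.prod ν) := by
    have hQ' : AEStronglyMeasurable (fun q : (ℝ × ℝ) × ℝ => Q (q.1.1, q.2)) ((μ.prod ν).prod ν) :=
      hQ.aestronglyMeasurable.comp_quasiMeasurePreserving
        (MeasureTheory.QuasiMeasurePreserving.prodMap Measure.quasiMeasurePreserving_fst (.id ν))
    exact (hQ'.indicator (s := {q | q.2 ≤ q.1.2})
      (measurableSet_le (by fun_prop) (by fun_prop))).integral_prod_right'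
  have hle (p : ℝ × ℝ) (hp : p ∈ period T ×ˢ Ioc 0 R) : verticalPrimitive Q p =
      ∫ t, (Iic p.2).indicator (fun t => Q (p.1, t)) t ∂ν :=
    verticalPrimitive_eq_integral_indicator Q hp.2
  have hbound : Integrable (fun p : ℝ × ℝ => ∫ t, ‖Q (p.1, t)‖ ∂ν) (μ.prod ν) :=
    hQ.norm.integral_prod_left.comp_fst ν
  have hslice : ∀ᵐ p ∂μ.prod ν, Integrable (fun t => Q (p.1, t)) ν :=
    Measure.quasiMeasurePreserving_fst.ae hQ.prod_right_ae
  rw [integrableOn_congr_fun hle (measurableSet_box T R), IntegrableOn, restrict_box]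
  refine hbound.mono' hmeas (hslice.mono fun p hp => ?_)
  refine (norm_integral_le_integral_norm _).trans (integral_mono_of_nonneg
    (ae_of_all _ fun t => norm_nonneg _) hp.norm (ae_of_all _ fun t => ?_))
  exact norm_indicator_le_norm_self _ t

end Box

section Extension

variable {s T : ℝ} {u : ℝ → ℝ} {Q : ℝ × ℝ → ℝ}

theorem integral_primitive_mul_deriv {q ψ : ℝ → ℝ} {R : ℝ} (hq : IntervalIntegrable q volume 0 R)
    (hψ : ContDiff ℝ 1 ψ) (hψR : ψ R = 0) (c : ℝ) :
    ∫ y in (0)..R, (c + ∫ t in (0)..y, q t) * deriv ψ y =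
      -(∫ y in (0)..R, q y * ψ y) - c * ψ 0 := by
  have hac : AbsolutelyContinuousOnInterval (fun y => c + ∫ t in (0)..y, q t) 0 R :=
    contDiffOn_const.absolutelyContinuousOnInterval.add
      (hq.absolutelyContinuousOnInterval_intervalIntegral left_mem_uIcc)
  have hderiv : ∫ y in (0)..R, deriv (fun y => c + ∫ t in (0)..y, q t) y * ψ y =
      ∫ y in (0)..R, q y * ψ y := by
    refine intervalIntegral.integral_congr_ae ?_
    filter_upwards [hq.ae_hasDerivAt_integral] with y hy hmem
    rw [((hy (uIoc_subset_uIcc hmem) 0 left_mem_uIcc).const_add c).deriv]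
  rw [hac.integral_mul_deriv_eq_deriv_mul hψ.contDiffOn.absolutelyContinuousOnInterval, hderiv,
    hψR, intervalIntegral.integral_same]
  ring

/-- The function on the strip with boundary values `u` and vertical derivative `Q`, extended
periodically. -/
def extension (hT : 0 < T) (u : ℝ → ℝ) (Q : ℝ × ℝ → ℝ) (p : ℝ × ℝ) : ℝ :=
  u (toIocMod hT (-(T / 2)) p.1) + verticalPrimitive Q (toIocMod hT (-(T / 2)) p.1, p.2)

theorem toIocMod_eq_of_mem_period (hT : 0 < T) {x : ℝ} (hx : x ∈ period T) :
    toIocMod hT (-(T / 2)) x = x :=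
  (toIocMod_eq_self hT).2 ⟨hx.1, hx.2.trans (by linarith)⟩

theorem extension_apply (hT : 0 < T) (u : ℝ → ℝ) (Q : ℝ × ℝ → ℝ) {p : ℝ × ℝ}
    (hp : p.1 ∈ period T) : extension hT u Q p = u p.1 + verticalPrimitive Q p := by
  rw [extension, toIocMod_eq_of_mem_period hT hp]

theorem extension_zero (hT : 0 < T) (u : ℝ → ℝ) (Q : ℝ × ℝ → ℝ) (x : ℝ) :
    extension hT u Q (x, 0) = u (toIocMod hT (-(T / 2)) x) := by
  rw [extension, verticalPrimitive, intervalIntegral.integral_same, add_zero]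

theorem integrableOn_extension (hT : 0 < T) {R : ℝ} (hu : IntegrableOn u (period T))
    (hQ : IntegrableOn Q (period T ×ˢ Ioc 0 R)) :
    IntegrableOn (extension hT u Q) (period T ×ˢ Ioc 0 R) := by
  have hu' : IntegrableOn (fun p : ℝ × ℝ => u p.1) (period T ×ˢ Ioc 0 R) := by
    rw [IntegrableOn, restrict_box]
    exact hu.comp_fst _
  exact (hu'.add (integrableOn_verticalPrimitive hQ)).congr_fun
    (fun p hp => (extension_apply hT u Q hp.1).symm) (measurableSet_box T R)

theorem IsTest.exists_common_bound {φ ψ : ℝ × ℝ → ℝ} (hφ : IsTest T φ) (hψ : IsTest T ψ) :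
    ∃ R : ℝ, 0 < R ∧ (∀ x y, R ≤ |y| → φ (x, y) = 0) ∧ ∀ x y, R ≤ |y| → ψ (x, y) = 0 := by
  obtain ⟨-, R, hR, -, hφR⟩ := hφ.exists_bound
  obtain ⟨-, R', -, -, hψR⟩ := hψ.exists_bound
  exact ⟨max R R', lt_max_of_lt_left hR, fun x y hy => hφR x y ((le_max_left _ _).trans hy),
    fun x y hy => hψR x y ((le_max_right _ _).trans hy)⟩

theorem IsTest.integrableOn_mul_box {f φ : ℝ × ℝ → ℝ} {R : ℝ} (hφ : IsTest T φ)
    (hf : IntegrableOn f (period T ×ˢ Ioc 0 R)) :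
    IntegrableOn (fun p => f p * φ p) (period T ×ˢ Ioc 0 R) := by
  obtain ⟨M, -, -, hM, -⟩ := hφ.exists_bound
  exact Integrable.mul_bdd (c := M) hf hφ.continuous.aestronglyMeasurable
    ((ae_restrict_iff' (measurableSet_box T R)).2 (ae_of_all _ fun p hp => hM p.1 hp.1 p.2))

theorem integral_slice_extension_mul_fderiv (hT : 0 < T) {φ : ℝ × ℝ → ℝ} (hφ : IsTest T φ) {R : ℝ}
    (hR : 0 ≤ R) (hφR : ∀ x y, R ≤ |y| → φ (x, y) = 0) {x : ℝ} (hx : x ∈ period T)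
    (hQ : IntegrableOn (fun y => Q (x, y)) (Ioc 0 R)) :
    ∫ y in Ioc 0 R, extension hT u Q (x, y) * fderiv ℝ φ (x, y) (0, 1) =
      -(∫ y in Ioc 0 R, Q (x, y) * φ (x, y)) - u x * φ (x, 0) := by
  have hslice : ContDiff ℝ 1 fun y => φ (x, y) :=
    (contDiff_infty.1 hφ.smooth 1).comp (contDiff_const.prodMk contDiff_id)
  simp only [← intervalIntegral.integral_of_le hR,
    ← (hasDerivAt_vertical_slice hφ.differentiable x _).deriv,
    extension_apply hT u Q (p := (x, _)) hx, verticalPrimitive]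
  exact integral_primitive_mul_deriv ((intervalIntegrable_iff_integrableOn_Ioc_of_le hR).2 hQ)
    hslice (hφR x R (le_abs_self R)) (u x)

theorem integral_extension_mul_fderiv (hT : 0 < T) (hu : IntegrableOn u (period T))
    (hQ : ∀ R, IntegrableOn Q (period T ×ˢ Ioc 0 R)) {φ : ℝ × ℝ → ℝ} (hφ : IsTest T φ) :
    ∫ p in strip T, extension hT u Q p * fderiv ℝ φ p (0, 1) =
      -(∫ p in strip T, Q p * φ p) - ∫ x in period T, u x * φ (x, 0) := by
  have hφ' := hφ.fderiv_apply (0, 1)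
  obtain ⟨R, hR, hφR, hφR'⟩ := hφ.exists_common_bound hφ'
  have hleft := hφ'.integrableOn_mul_box (integrableOn_extension hT hu (hQ R))
  have hright := hφ.integrableOn_mul_box (hQ R)
  have htrace : IntegrableOn (fun x => u x * φ (x, 0)) (period T) := by
    obtain ⟨M, -, -, hM, -⟩ := hφ.exists_bound
    have hcont : Continuous fun x => φ (x, 0) := hφ.continuous.comp (by fun_prop)
    exact Integrable.mul_bdd (c := M) hu hcont.aestronglyMeasurable
      ((ae_restrict_iff' measurableSet_Ioc).2 (ae_of_all _ fun x hx => hM x hx 0))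
  rw [setIntegral_strip_eq_box fun x y hy => by rw [hφR' x y hy, mul_zero],
    setIntegral_strip_eq_box fun x y hy => by rw [hφR x y hy, mul_zero]]
  have hQ' := hQ R
  rw [IntegrableOn, restrict_box] at hleft hright hQ'
  rw [restrict_box, integral_prod _ hleft, integral_prod _ hright, ← integral_neg,
    ← integral_sub hright.integral_prod_left.fun_neg htrace]
  refine integral_congr_ae ?_
  filter_upwards [hQ'.prod_right_ae, ae_restrict_mem measurableSet_Ioc] with x hx hmem
  exact integral_slice_extension_mul_fderiv hT hφ hR.le hφR hmem hx

theorem integral_extension_mul_fderiv_dx (hT : 0 < T) {P : ℝ × ℝ → ℝ}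
    (hu : IntegrableOn u (period T)) (hQ : ∀ R, IntegrableOn Q (period T ×ˢ Ioc 0 R))
    (hgrad : IsTraceGradient T u P Q) {φ : ℝ × ℝ → ℝ} (hφ : IsTest T φ) :
    ∫ p in strip T, extension hT u Q p * fderiv ℝ φ p (1, 0) = -∫ p in strip T, P p * φ p := by
  have hΦ := isTest_cutTailPrimitive hφ
  have hcurl := hgrad _ hΦ
  have hparts := integral_extension_mul_fderiv hT hu hQ (hΦ.fderiv_apply (1, 0))
  have hmixed (p : ℝ × ℝ) (hp : p ∈ strip T) :
      fderiv ℝ (fun q => fderiv ℝ (cutTailPrimitive φ) q (1, 0)) p (0, 1) =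
        -fderiv ℝ φ p (1, 0) := by
    have hopen : IsOpen {q : ℝ × ℝ | 0 < q.2} := isOpen_lt continuous_const continuous_snd
    have heq : (fun q => fderiv ℝ (cutTailPrimitive φ) q (0, 1)) =ᶠ[𝓝 p] fun q => -φ q := by
      filter_upwards [hopen.mem_nhds hp.2] with q hq
      exact fderiv_cutTailPrimitive hφ hq
    rw [hΦ.fderiv_fderiv_comm, heq.fderiv_eq, fderiv_fun_neg, neg_apply]
  rw [setIntegral_congr_fun (measurableSet_strip T) fun p hp =>
    congrArg (extension hT u Q p * ·) (hmixed p hp)] at hparts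
  rw [setIntegral_congr_fun (measurableSet_strip T) fun p hp =>
    congrArg (P p * ·) (fderiv_cutTailPrimitive hφ hp.2)] at hcurl
  simp only [mul_neg, integral_neg] at hparts hcurl
  linarith

theorem memL2_periodization (hT : 0 < T) (hu : MemLp u 2 (volume.restrict (period T))) :
    MemL2 T fun x => u (toIocMod hT (-(T / 2)) x) where
  periodic x := by simp only [toIocMod_add_right]
  memLp := by
    refine hu.ae_eq ?_
    filter_upwards [ae_restrict_mem measurableSet_Ioc] with x hx
    rw [toIocMod_eq_of_mem_period hT hx]

theorem memEnergy_extension (hs : 0 < s) (hT : 0 < T) {P : ℝ × ℝ → ℝ}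
    (hu : MemLp u 2 (volume.restrict (period T))) (hP : MemLp P 2 (weight s T))
    (hQ : MemLp Q 2 (weight s T)) (hgrad : IsTraceGradient T u P Q) :
    MemEnergy s T (extension hT u Q) P Q := by
  have hu1 : IntegrableOn u (period T) := hu.integrable one_le_two
  have hQ1 := integrableOn_box_of_memLp hs hQ
  refine ⟨fun x y _ => by simp only [extension, toIocMod_add_right],
    fun R => integrableOn_extension hT hu1 (hQ1 R), ?_, hP, hQ, fun φ hφ =>
      integral_extension_mul_fderiv_dx hT hu1 hQ1 hgrad hφ, fun φ hφ => ?_⟩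
  · simp only [extension_zero]
    exact memL2_periodization hT hu
  · rw [integral_extension_mul_fderiv hT hu1 hQ1 hφ]
    congr 1
    refine setIntegral_congr_fun measurableSet_Ioc fun x hx => ?_
    simp only [extension_zero, toIocMod_eq_of_mem_period hT hx]

end Extension

section Form

variable {s T : ℝ} {k : ℝ → ℝ} {U P Q V P' Q' : ℝ × ℝ → ℝ}

/-- Multiplication by a bounded function on the `L²` space of a period. -/
def mulOp (T : ℝ) (hk : MemLp k ⊤ (volume.restrict (period T))) :
    TraceSpace T →L[ℝ] TraceSpace T :=
  (ContinuousLinearMap.mul ℝ ℝ).holderL (volume.restrict (period T)) ⊤ 2 2 hk.toLp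

theorem mulOp_coeFn (hk : MemLp k ⊤ (volume.restrict (period T))) (f : TraceSpace T) :
    mulOp T hk f =ᵐ[volume.restrict (period T)] fun x => k x * f x := by
  have hmul := (ContinuousLinearMap.mul ℝ ℝ).coeFn_holder (r := 2) hk.toLp f
  filter_upwards [hmul, hk.coeFn_toLp] with x hx hkx
  rw [hkx] at hx
  exact hx

theorem inner_mulOp (hk : MemLp k ⊤ (volume.restrict (period T))) (f g : TraceSpace T) :
    ⟪mulOp T hk f, g⟫_ℝ = ∫ x in period T, k x * f x * g x := by
  rw [L2.inner_def]
  refine integral_congr_ae ?_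
  filter_upwards [mulOp_coeFn hk f] with x hx
  rw [hx, real_inner_eq_re_inner, RCLike.inner_apply', conj_trivial, RCLike.re_to_real]

/-- The bilinear form `form s T k` on the Hilbert space of functions of finite energy. -/
def energyForm (hs : 0 < s) (hk : MemLp k ⊤ (volume.restrict (period T))) :
    energySpace T hs →L[ℝ] energySpace T hs →L[ℝ] ℝ :=
  dConst s • ((innerSL ℝ).bilinearComp (dxMap T hs) (dxMap T hs) +
    (innerSL ℝ).bilinearComp (dyMap T hs) (dyMap T hs)) +
      (innerSL ℝ).bilinearComp ((mulOp T hk).comp (traceMap T hs)) (traceMap T hs)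

theorem energyForm_apply (hs : 0 < s) (hk : MemLp k ⊤ (volume.restrict (period T)))
    (h h' : energySpace T hs) : energyForm hs hk h h' =
      dConst s * (⟪dxMap T hs h, dxMap T hs h'⟫_ℝ + ⟪dyMap T hs h, dyMap T hs h'⟫_ℝ) +
        ⟪mulOp T hk (traceMap T hs h), traceMap T hs h'⟫_ℝ := rfl

theorem energyForm_symm (hs : 0 < s) (hk : MemLp k ⊤ (volume.restrict (period T)))
    (h h' : energySpace T hs) : energyForm hs hk h h' = energyForm hs hk h' h := by
  rw [energyForm_apply, energyForm_apply, real_inner_comm (dxMap T hs h),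
    real_inner_comm (dyMap T hs h), inner_mulOp, inner_mulOp]
  congr 2 with x
  exact mul_right_comm _ _ _

theorem dConst_pos (hs : s ∈ Ioo 0 1) : 0 < dConst s := by
  have hΓ := Real.Gamma_pos_of_pos hs.1
  have hΓ' := Real.Gamma_pos_of_pos (sub_pos.2 hs.2)
  unfold dConst
  positivity

theorem isGarding_energyForm (hs : s ∈ Ioo 0 1) (hk : MemLp k ⊤ (volume.restrict (period T))) :
    IsGarding (H := energySpace T hs.1) (traceMap T hs.1) (energyForm hs.1 hk) (dConst s)
      (‖mulOp T hk‖ + dConst s) where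
  pos := dConst_pos hs
  bound h := by
    have hpot : |⟪mulOp T hk (traceMap T hs.1 h), traceMap T hs.1 h⟫_ℝ| ≤
        ‖mulOp T hk‖ * ‖traceMap T hs.1 h‖ ^ 2 := by
      rw [sq, ← mul_assoc]
      exact (abs_real_inner_le_norm _ _).trans (by gcongr; exact (mulOp T hk).le_opNorm _)
    rw [energyForm_apply, real_inner_self_eq_norm_sq, real_inner_self_eq_norm_sq,
      norm_sq_energySpace]
    linarith [neg_abs_le ⟪mulOp T hk (traceMap T hs.1 h), traceMap T hs.1 h⟫_ℝ]

theorem inner_toLp_toLp {α : Type*} [MeasurableSpace α] {μ : Measure α} {f g : α → ℝ}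
    (hf : MemLp f 2 μ) (hg : MemLp g 2 μ) : ⟪hf.toLp, hg.toLp⟫_ℝ = ∫ x, f x * g x ∂μ := by
  rw [inner_toLp_eq_integral]
  exact integral_congr_ae (hg.coeFn_toLp.mono fun x hx => congrArg (f x * ·) hx)

theorem form_eq_energyForm (hs : 0 < s) (hk : MemLp k ⊤ (volume.restrict (period T)))
    (hU : MemEnergy s T U P Q) (hV : MemEnergy s T V P' Q') :
    form s T k U P Q V P' Q' =
      energyForm hs hk (hU.toEnergySpace hs) (hV.toEnergySpace hs) := by
  have hdx : Integrable (fun p => P p * P' p) (weight s T) :=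
    hU.memLp_dx.integrable_mul hV.memLp_dx
  have hdy : Integrable (fun p => Q p * Q' p) (weight s T) :=
    hU.memLp_dy.integrable_mul hV.memLp_dy
  rw [energyForm_apply, form, integral_add hdx hdy, ← inner_toLp_toLp hU.memLp_dx hV.memLp_dx,
    ← inner_toLp_toLp hU.memLp_dy hV.memLp_dy, inner_mulOp]
  congr 1
  refine integral_congr_ae ?_
  filter_upwards [hU.trace_mem.memLp.coeFn_toLp, hV.trace_mem.memLp.coeFn_toLp] with x hx hx'
  exact congrArg₂ (k x * · * ·) hx.symm hx'.symm

theorem exists_memEnergy_toEnergySpace_eq {hs : 0 < s} (hT : 0 < T) {u : ℝ → ℝ} (hu : MemL2 T u)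
    {h : energySpace T hs} (htrace : traceMap T hs h = hu.memLp.toLp) :
    ∃ U P Q, ∃ hU : MemEnergy s T U P Q, (∀ x, U (x, 0) = u x) ∧ hU.toEnergySpace hs = h := by
  have hae : traceMap T hs h =ᵐ[volume.restrict (period T)] u :=
    htrace ▸ hu.memLp.coeFn_toLp
  have hgrad : IsTraceGradient T u (dxMap T hs h) (dyMap T hs h) :=
    (isTraceGradient_congr_ae (s := s) hae .rfl .rfl).1 (isTraceGradient_of_energySpace h)
  have hU := memEnergy_extension hs hT hu.memLp (Lp.memLp _) (Lp.memLp _) hgrad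
  have hUu (x : ℝ) : extension hT u (dyMap T hs h) (x, 0) = u x := by
    rw [extension_zero]
    exact hu.periodic.sub_zsmul_eq _
  have htr : hU.trace_mem.memLp.toLp = traceMap T hs h :=
    (MemLp.toLp_congr _ hu.memLp (ae_of_all _ hUu)).trans htrace.symm
  refine ⟨_, _, _, hU, hUu, Subtype.ext ?_⟩
  change WithLp.toLp 2 (_, WithLp.toLp 2 (_, _)) = h.1
  rw [htr, Lp.toLp_coeFn, Lp.toLp_coeFn]
  rfl

theorem exists_memL2_toLp_eq (hT : 0 < T) (f : TraceSpace T) :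
    ∃ u, ∃ hu : MemL2 T u, hu.memLp.toLp = f := by
  refine ⟨_, memL2_periodization hT (Lp.memLp f), Lp.ext ((MemLp.coeFn_toLp _).trans ?_)⟩
  filter_upwards [ae_restrict_mem measurableSet_Ioc] with x hx
  rw [toIocMod_eq_of_mem_period hT hx]

end Form

section WeakSolutions

variable {s T lam : ℝ} {k g u v : ℝ → ℝ}

theorem memL2_zero (T : ℝ) : MemL2 T 0 := ⟨fun _ => rfl, MemLp.zero⟩

theorem isWeakSolution_iff (hs : 0 < s) (hT : 0 < T)
    (hk : MemLp k ⊤ (volume.restrict (period T))) (hg : MemL2 T g) :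
    IsWeakSolution s T k (fun x => lam * u x + g x) u ↔
      ∃ (hu : MemL2 T u) (h : energySpace T hs), traceMap T hs h = hu.memLp.toLp ∧
        IsFormSolution (traceMap T hs) (energyForm hs hk) lam hg.memLp.toLp h := by
  have hrhs (hu : MemL2 T u) {V P Q : ℝ × ℝ → ℝ} (hV : MemEnergy s T V P Q) :
      ∫ x in period T, (lam * u x + g x) * V (x, 0) =
        lam * ⟪hu.memLp.toLp, traceMap T hs (hV.toEnergySpace hs)⟫_ℝ +
          ⟪hg.memLp.toLp, traceMap T hs (hV.toEnergySpace hs)⟫_ℝ := by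
    rw [← real_inner_smul_left, ← inner_add_left]
    exact (inner_toLp_toLp ((hu.memLp.const_mul lam).add hg.memLp) hV.trace_mem.memLp).symm
  constructor
  · rintro ⟨U, P, Q, hU, hUu, hweak⟩
    obtain rfl : (fun x => U (x, 0)) = u := funext hUu
    refine ⟨hU.trace_mem, hU.toEnergySpace hs, rfl, fun h' => ?_⟩
    obtain ⟨v, hv, hv'⟩ := exists_memL2_toLp_eq hT (traceMap T hs h')
    obtain ⟨V, P', Q', hV, -, rfl⟩ := exists_memEnergy_toEnergySpace_eq hT hv hv'.symm
    rw [← form_eq_energyForm, hweak V P' Q' hV, hrhs hU.trace_mem hV]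
    rfl
  · rintro ⟨hu, h, htrace, hsol⟩
    obtain ⟨U, P, Q, hU, hUu, rfl⟩ := exists_memEnergy_toEnergySpace_eq hT hu htrace
    refine ⟨U, P, Q, hU, hUu, fun V P' Q' hV => ?_⟩
    rw [form_eq_energyForm hs hk hU hV, hsol, htrace, hrhs hu hV]

theorem ae_eq_of_periodic (hT : 0 < T) (hu : Function.Periodic u T) (hv : Function.Periodic v T)
    (h : u =ᵐ[volume.restrict (period T)] v) : u =ᵐ[volume] v := by
  have hdom : IsAddFundamentalDomain (AddSubgroup.zmultiples T) (period T) := by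
    have := isAddFundamentalDomain_Ioc hT (-(T / 2))
    rwa [show -(T / 2) + T = T / 2 by ring] at this
  refine hdom.measure_zero_of_invariant {x | u x = v x}ᶜ ?_ ?_
  · rintro ⟨_, n, rfl⟩
    ext x
    have hux : u (-(n • T) + x) = u x := by rw [neg_add_eq_sub, hu.sub_zsmul_eq n]
    have hvx : v (-(n • T) + x) = v x := by rw [neg_add_eq_sub, hv.sub_zsmul_eq n]
    rw [mem_vadd_set_iff_neg_vadd_mem]
    change ¬ u (-(n • T) + x) = v (-(n • T) + x) ↔ ¬ u x = v x
    rw [hux, hvx]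
  · rw [← Measure.restrict_apply' (show MeasurableSet (period T) from measurableSet_Ioc)]
    exact h

theorem MemL2.toLp_eq_toLp_iff (hT : 0 < T) (hu : MemL2 T u) (hv : MemL2 T v) :
    hu.memLp.toLp = hv.memLp.toLp ↔ u =ᵐ[volume] v :=
  (MemLp.toLp_eq_toLp_iff hu.memLp hv.memLp).trans
    ⟨ae_eq_of_periodic hT hu.periodic hv.periodic, fun h => ae_restrict_of_ae h⟩

theorem isEigenvalue_iff_isFormEigenvalue (hs : s ∈ Ioo 0 1) (hT : 0 < T)
    (hk : MemLp k ⊤ (volume.restrict (period T))) :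
    IsEigenvalue s T k lam ↔
      IsFormEigenvalue (H := energySpace T hs.1) (traceMap T hs.1) (energyForm hs.1 hk) lam := by
  have hsol (u : ℝ → ℝ) := isWeakSolution_iff (lam := lam) (u := u) hs.1 hT hk (memL2_zero T)
  simp only [Pi.zero_apply, add_zero, show (memL2_zero T).memLp.toLp = 0 from MemLp.toLp_zero _]
    at hsol
  constructor
  · rintro ⟨u, hu, hu0⟩
    obtain ⟨hu2, h, htrace, hh⟩ := (hsol u).1 hu
    refine ⟨h, fun h0 => hu0 ?_, hh⟩
    rw [← hu2.toLp_eq_toLp_iff hT (memL2_zero T), ← htrace, h0, map_zero]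
    exact (MemLp.toLp_zero _).symm
  · rintro ⟨h, h0, hh⟩
    obtain ⟨u, hu, htrace⟩ := exists_memL2_toLp_eq hT (traceMap T hs.1 h)
    refine ⟨u, (hsol u).2 ⟨hu, h, htrace.symm, hh⟩, fun hu0 => h0 ?_⟩
    refine (isGarding_energyForm hs hk).eq_zero_of_map_eq_zero hh ?_
    rw [← htrace, (hu.toLp_eq_toLp_iff hT (memL2_zero T)).2 hu0]
    exact MemLp.toLp_zero _

theorem uniquelySolvable_of_not_isEigenvalue (hs : s ∈ Ioo 0 1) (hT : 0 < T)
    (hk : MemLp k ⊤ (volume.restrict (period T))) (hlam : ¬ IsEigenvalue s T k lam)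
    (hg : MemL2 T g) : UniquelySolvable s T k lam g := by
  rw [isEigenvalue_iff_isFormEigenvalue hs hT hk] at hlam
  constructor
  · obtain ⟨h, hh⟩ := (isGarding_energyForm hs hk).exists_isFormSolution
      (isCompactOperator_traceMap hs.1 hT) hlam hg.memLp.toLp
    obtain ⟨u, hu, htrace⟩ := exists_memL2_toLp_eq hT (traceMap T hs.1 h)
    exact ⟨u, (isWeakSolution_iff hs.1 hT hk hg).2 ⟨hu, h, htrace.symm, hh⟩⟩
  · intro u v hu hv
    obtain ⟨hu2, h, hhu, hh⟩ := (isWeakSolution_iff hs.1 hT hk hg).1 hu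
    obtain ⟨hv2, h', hhv, hh'⟩ := (isWeakSolution_iff hs.1 hT hk hg).1 hv
    have heq : h = h' := by
      by_contra hne
      exact hlam ⟨h - h', sub_ne_zero.2 hne, hh.sub hh'⟩
    rw [← hu2.toLp_eq_toLp_iff hT hv2, ← hhu, ← hhv, heq]

theorem forall_uniquelySolvable_iff (hs : s ∈ Ioo 0 1) (hT : 0 < T)
    (hk : MemLp k ⊤ (volume.restrict (period T))) :
    (∀ g, MemL2 T g → UniquelySolvable s T k lam g) ↔ ¬ IsEigenvalue s T k lam := by
  refine ⟨?_, fun hlam g hg => uniquelySolvable_of_not_isEigenvalue hs hT hk hlam hg⟩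
  rintro h ⟨u, hu, hu0⟩
  have hzero : IsWeakSolution s T k (fun x => lam * (0 : ℝ → ℝ) x + (0 : ℝ → ℝ) x) 0 :=
    (isWeakSolution_iff hs.1 hT hk (memL2_zero T)).2
      ⟨memL2_zero T, 0, by rw [map_zero]; exact (MemLp.toLp_zero _).symm, fun h' => by
        simp [MemLp.toLp_zero]⟩
  exact hu0 ((h 0 (memL2_zero T)).2 u 0 (by simpa using hu) hzero)

theorem finite_eigenvalues_inter_Iic (hs : s ∈ Ioo 0 1) (hT : 0 < T)
    (hk : MemLp k ⊤ (volume.restrict (period T))) (C : ℝ) :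
    ({lam | IsEigenvalue s T k lam} ∩ Iic C).Finite := by
  simp only [isEigenvalue_iff_isFormEigenvalue hs hT hk]
  exact (isGarding_energyForm hs hk).finite_eigenvalues_inter_Iic
    (isCompactOperator_traceMap hs.1 hT) (energyForm_symm hs.1 hk) C

end WeakSolutions

theorem theorem2p3_general (s T : ℝ) (hs : s ∈ Ioo (0 : ℝ) 1) (hT : 0 < T) (k : ℝ → ℝ)
    (hk : MemLp k ⊤ (volume.restrict (period T))) :
    ∃ S : Set ℝ, S.Countable ∧ (∀ lam ∈ S, IsEigenvalue s T k lam) ∧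
      (∀ lam : ℝ, (∀ g : ℝ → ℝ, MemL2 T g → UniquelySolvable s T k lam g) ↔ lam ∉ S) ∧
      (S.Infinite → ∃ l : ℕ → ℝ, Monotone l ∧ range l = S ∧ Tendsto l atTop atTop) := by
  have hfin := finite_eigenvalues_inter_Iic hs hT hk
  exact ⟨{lam | IsEigenvalue s T k lam}, countable_of_finite_inter_Iic hfin, fun _ hlam => hlam,
    fun _ => forall_uniquelySolvable_iff hs hT hk, exists_monotone_tendsto_atTop_range_eq hfin⟩

end PeriodicFractional

end

theorem theorem2p3 (s T : ℝ) (hs : s ∈ Set.Ioo (0 : ℝ) 1) (hT : 0 < T)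
    (k : ℝ → ℝ) (hk_meas : MeasureTheory.AEStronglyMeasurable k MeasureTheory.volume)
    (hk_per : Function.Periodic k T) (hk_bdd : ∃ M : ℝ, ∀ x, |k x| ≤ M) :
    ∃ S : Set ℝ, S.Countable ∧
      (∀ lam ∈ S, PeriodicFractional.IsEigenvalue s T k lam) ∧
      (∀ lam : ℝ,
        (∀ g : ℝ → ℝ, PeriodicFractional.MemL2 T g →
          PeriodicFractional.UniquelySolvable s T k lam g) ↔ lam ∉ S) ∧
      (S.Infinite → ∃ l : ℕ → ℝ, Monotone l ∧ Set.range l = S ∧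
        Filter.Tendsto l Filter.atTop Filter.atTop) := by
  obtain ⟨M, hM⟩ := hk_bdd
  exact PeriodicFractional.theorem2p3_general s T hs hT k
    (memLp_top_of_bound hk_meas.restrict M (ae_of_all _ hM))
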